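/- Let $n\ge 3$ and let $(M,g_{ab})$ be a spacetime: an $n$-dimensional smooth, Hausdorff, paracompact, connected, orientable manifold with a smooth Lorentzian metric of signature $(+,-,\dots,-)$ and a chosen time orientation. Suppose that $(M,g_{ab})$ is of class A, that is: 1. The Einstein equations $R_{ab}-\tfrac12 g_{ab}R+\widetilde\Lambda g_{ab}=8\pi T_{ab}$ hold with some cosmological constant $\widetilde\Lambda\in\mathbb R$, and the energy-momentum tensor $T_{ab}$ satisfies the dominant energy condition: for each future directed timelike vector $\xi^a$, the vector ${T^a}_b\xi^b$ is zero or future directed timelike or null. 2. There is a smooth (global) one-parameter group $\chi_u$, $u\in\mathbb R$, of isometries of $(M,g_{ab})$, generated by a Killing vector field $\mathfrak K^a$, and it admits a connected Killing horizon $\mathcal N$: a smooth embedded null hypersurface of $M$ that is invariant under $\chi_u$ and on which $\mathfrak K^a$ is null. Moreover $\mathfrak K^a$ is future directed on $\mathcal N$, and $\chi_u$ has no fixed point on $\mathcal N$. 3. $\mathcal N$ has a smooth global cross-section $\mathcal Z$, a compact orientable $(n-2)$-dimensional manifold without boundary: the orbits of $\chi_u$ on $\mathcal N$ are diffeomorphic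 to $\mathbb R$, each meets $\mathcal Z$ precisely once, and $(u,z)\mapsto\chi_u(z)$ is a diffeomorphism $\mathbb R\times\mathcal Z\to\mathcal N$. Then there is exactly one function $\kappa_\circ:\mathcal N\to\mathbb R$ (the surface gravity) with $$\tfrac12\nabla^a(\mathfrak K^e\mathfrak K_e)=-\kappa_\circ\,\mathfrak K^a\quad\text{on }\mathcal N,$$ and $\kappa_\circ$ is constant throughout $\mathcal N$ (the zeroth law). Moreover, ${T^a}_b\mathfrak K^b$ points in the direction of $\mathfrak K^a$ on $\mathcal N$: at each point of $\mathcal N$ there is a number $\varphi\ge 0$ with ${T^a}_b\mathfrak K^b=\varphi\,\mathfrak K^a$. -/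

import Mathlib

open scoped Manifold ContDiff Bundle
open Set

noncomputable section

/-- An `n`-dimensional smooth manifold is orientable if it can be covered by smooth charts all of
whose transition maps have positive Jacobian determinant. -/
def OrientableManifold (n : ℕ) (M : Type*) [TopologicalSpace M]
    [ChartedSpace (EuclideanSpace ℝ (Fin n)) M] : Prop :=
  ∃ A ⊆ IsManifold.maximalAtlas (𝓡 n) ∞ M,
    (∀ p : M, ∃ e ∈ A, p ∈ e.source) ∧
    ∀ e ∈ A, ∀ e' ∈ A, ∀ y ∈ (e.symm ≫ₕ e').source,
      0 < (fderiv ℝ (e.symm ≫ₕ e') y).det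

/-- A smooth Lorentzian metric of signature `(+,-,…,-)`. -/
structure LorentzMetric (n : ℕ) (M : Type*) [TopologicalSpace M]
    [ChartedSpace (EuclideanSpace ℝ (Fin n)) M] [IsManifold (𝓡 n) ∞ M] where
  /-- The bilinear form `g_{ab}` on each tangent space. -/
  val (p : M) : TangentSpace (𝓡 n) p →L[ℝ] TangentSpace (𝓡 n) p →L[ℝ] ℝ
  symm (p : M) (v w : TangentSpace (𝓡 n) p) : val p v w = val p w v
  /-- Signature `(+,-,…,-)`: some vector has positive square, and the form is negative definite
  on its orthogonal complement. -/
  signature (p : M) : ∃ v : TangentSpace (𝓡 n) p, 0 < val p v v ∧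
    ∀ w : TangentSpace (𝓡 n) p, val p v w = 0 → w ≠ 0 → val p w w < 0
  smooth : ContMDiff (𝓡 n)
    ((𝓡 n).prod 𝓘(ℝ, EuclideanSpace ℝ (Fin n) →L[ℝ] EuclideanSpace ℝ (Fin n) →L[ℝ] ℝ)) ∞
    (fun p ↦ Bundle.TotalSpace.mk'
      (EuclideanSpace ℝ (Fin n) →L[ℝ] EuclideanSpace ℝ (Fin n) →L[ℝ] ℝ)
      (E := fun p : M ↦ TangentSpace (𝓡 n) p →L[ℝ] TangentSpace (𝓡 n) p →L[ℝ] ℝ) p (val p))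

namespace LorentzMetric

variable {n : ℕ} {M : Type*} [TopologicalSpace M]
    [ChartedSpace (EuclideanSpace ℝ (Fin n)) M] [IsManifold (𝓡 n) ∞ M]

theorem eq_zero_of_forall (g : LorentzMetric n M) (p : M) (v : TangentSpace (𝓡 n) p)
    (h : ∀ w, g.val p v w = 0) : v = 0 := by
  obtain ⟨t, -, ht⟩ := g.signature p
  by_contra hv
  have h1 := ht v (by rw [g.symm, h]) hv
  rw [h v] at h1
  exact lt_irrefl _ h1

/-- Lowering an index, `v ↦ g_{ab} v^a`, is bijective. -/
theorem lower_bijective (g : LorentzMetric n M) (p : M) : Function.Bijective (g.val p) := by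
  have : FiniteDimensional ℝ (TangentSpace (𝓡 n) p) :=
    inferInstanceAs (FiniteDimensional ℝ (EuclideanSpace ℝ (Fin n)))
  have : T2Space (TangentSpace (𝓡 n) p) :=
    inferInstanceAs (T2Space (EuclideanSpace ℝ (Fin n)))
  have hinj : Function.Injective (g.val p).toLinearMap := by
    rw [← LinearMap.ker_eq_bot, LinearMap.ker_eq_bot']
    intro v hv
    exact g.eq_zero_of_forall p v (fun w ↦ congrArg (fun l ↦ l w) hv)
  have hdim : Module.finrank ℝ (TangentSpace (𝓡 n) p) =
      Module.finrank ℝ (TangentSpace (𝓡 n) p →L[ℝ] ℝ) := by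
    rw [← (LinearMap.toContinuousLinearMap :
      (TangentSpace (𝓡 n) p →ₗ[ℝ] ℝ) ≃ₗ[ℝ] _).finrank_eq]
    exact Subspace.dual_finrank_eq.symm
  exact ⟨hinj, (LinearMap.injective_iff_surjective_of_finrank_eq_finrank hdim).1 hinj⟩

/-- Raising an index: `α_b ↦ g^{ab} α_b`. -/
def raise (g : LorentzMetric n M) (p : M) (α : TangentSpace (𝓡 n) p →L[ℝ] ℝ) :
    TangentSpace (𝓡 n) p :=
  (Equiv.ofBijective _ (g.lower_bijective p)).symm α

theorem val_raise (g : LorentzMetric n M) (p : M) (α : TangentSpace (𝓡 n) p →L[ℝ] ℝ)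
    (w : TangentSpace (𝓡 n) p) : g.val p (g.raise p α) w = α w :=
  congrArg (fun l ↦ l w) ((Equiv.ofBijective _ (g.lower_bijective p)).apply_symm_apply α)

/-- The gradient `∇^a f` of a scalar function. -/
def grad (g : LorentzMetric n M) (f : M → ℝ) (p : M) : TangentSpace (𝓡 n) p :=
  g.raise p (mvfderiv (𝓡 n) f p)

end LorentzMetric

section Coordinates

variable {n : ℕ} {M : Type*} [TopologicalSpace M]
    [ChartedSpace (EuclideanSpace ℝ (Fin n)) M]

/-- The coordinate basis vector `∂/∂x^i` of the chart `φ`, at the point with coordinates `y`. -/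
def coordVector (φ : OpenPartialHomeomorph M (EuclideanSpace ℝ (Fin n))) (i : Fin n)
    (y : EuclideanSpace ℝ (Fin n)) : TangentSpace (𝓡 n) (φ.symm y) :=
  mfderiv (𝓡 n) (𝓡 n) φ.symm y (EuclideanSpace.single i (1 : ℝ))

/-- The components `B_{ij}` of a field of bilinear forms in the chart `φ`, as functions of the
coordinates. -/
def components (B : ∀ p : M, TangentSpace (𝓡 n) p →L[ℝ] TangentSpace (𝓡 n) p →L[ℝ] ℝ)
    (φ : OpenPartialHomeomorph M (EuclideanSpace ℝ (Fin n))) (i j : Fin n)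
    (y : EuclideanSpace ℝ (Fin n)) : ℝ :=
  B (φ.symm y) (coordVector φ i y) (coordVector φ j y)

/-- The partial derivative `∂_k f` of a function of the coordinates. -/
def partialDeriv (k : Fin n) (f : EuclideanSpace ℝ (Fin n) → ℝ)
    (y : EuclideanSpace ℝ (Fin n)) : ℝ :=
  fderiv ℝ f y (EuclideanSpace.single k (1 : ℝ))

end Coordinates

namespace LorentzMetric

variable {n : ℕ} {M : Type*} [TopologicalSpace M]
    [ChartedSpace (EuclideanSpace ℝ (Fin n)) M] [IsManifold (𝓡 n) ∞ M]

/-- The components `g^{ij}` of the inverse metric in the chart `φ`. -/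
def inverseComponents (g : LorentzMetric n M)
    (φ : OpenPartialHomeomorph M (EuclideanSpace ℝ (Fin n))) (i j : Fin n)
    (y : EuclideanSpace ℝ (Fin n)) : ℝ :=
  (Matrix.of fun a b ↦ components g.val φ a b y)⁻¹ i j

/-- The Christoffel symbols
`Γ^k_{ij} = ½ g^{kl} (∂_i g_{jl} + ∂_j g_{il} - ∂_l g_{ij})` in the chart `φ`. -/
def christoffel (g : LorentzMetric n M)
    (φ : OpenPartialHomeomorph M (EuclideanSpace ℝ (Fin n))) (k i j : Fin n)
    (y : EuclideanSpace ℝ (Fin n)) : ℝ :=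
  (1 / 2) * ∑ l, g.inverseComponents φ k l y *
    (partialDeriv i (components g.val φ j l) y + partialDeriv j (components g.val φ i l) y
      - partialDeriv l (components g.val φ i j) y)

/-- The components of the Ricci tensor in the chart `φ`,
`R_{ij} = ∂_k Γ^k_{ij} - ∂_j Γ^k_{ik} + Γ^k_{kl} Γ^l_{ij} - Γ^k_{jl} Γ^l_{ik}`
(round spheres with their positive definite metrics have positive Ricci tensor). -/
def ricci (g : LorentzMetric n M)
    (φ : OpenPartialHomeomorph M (EuclideanSpace ℝ (Fin n))) (i j : Fin n)
    (y : EuclideanSpace ℝ (Fin n)) : ℝ :=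
  ∑ k, (partialDeriv k (g.christoffel φ k i j) y - partialDeriv j (g.christoffel φ k i k) y) +
    ∑ k, ∑ l, (g.christoffel φ k k l y * g.christoffel φ l i j y
      - g.christoffel φ k j l y * g.christoffel φ l i k y)

/-- The scalar curvature `R = g^{ij} R_{ij}`, computed in the chart `φ`. -/
def scalarCurvature (g : LorentzMetric n M)
    (φ : OpenPartialHomeomorph M (EuclideanSpace ℝ (Fin n)))
    (y : EuclideanSpace ℝ (Fin n)) : ℝ :=
  ∑ i, ∑ j, g.inverseComponents φ i j y * g.ricci φ i j y

/-- The Einstein equations `R_{ab} - ½ g_{ab} R + Λ g_{ab} = 8π T_{ab}`, holding in every smooth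
local coordinate system. -/
def EinsteinEquations (g : LorentzMetric n M) (Λ : ℝ)
    (T : ∀ p : M, TangentSpace (𝓡 n) p →L[ℝ] TangentSpace (𝓡 n) p →L[ℝ] ℝ) : Prop :=
  ∀ φ ∈ IsManifold.maximalAtlas (𝓡 n) ∞ M, ∀ y ∈ φ.target, ∀ i j : Fin n,
    g.ricci φ i j y - (1 / 2) * components g.val φ i j y * g.scalarCurvature φ y
      + Λ * components g.val φ i j y = 8 * Real.pi * components T φ i j y

/-- `N` is a smooth (embedded) null hypersurface: near each of its points it is the zero set of a
smooth function with nowhere vanishing differential on `N`, whose gradient, the normal of `N`, is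
null on `N`. -/
def IsNullHypersurface (g : LorentzMetric n M) (N : Set M) : Prop :=
  ∀ p ∈ N, ∃ (U : Set M) (f : M → ℝ), IsOpen U ∧ p ∈ U ∧ ContMDiffOn (𝓡 n) 𝓘(ℝ, ℝ) ∞ f U ∧
    N ∩ U = {q ∈ U | f q = 0} ∧
    ∀ q ∈ N ∩ U, mvfderiv (𝓡 n) f q ≠ 0 ∧ g.val q (g.grad f q) (g.grad f q) = 0

end LorentzMetric

/-- A smooth orientable manifold with a Lorentzian metric and a time orientation, the latter given
by a continuous timelike vector field. -/
structure Spacetime (n : ℕ) (M : Type*) [TopologicalSpace M]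
    [ChartedSpace (EuclideanSpace ℝ (Fin n)) M] [IsManifold (𝓡 n) ∞ M] where
  orientable : OrientableManifold n M
  g : LorentzMetric n M
  timeField (p : M) : TangentSpace (𝓡 n) p
  timeField_continuous : Continuous fun p ↦ (⟨p, timeField p⟩ : TangentBundle (𝓡 n) M)
  timeField_timelike (p : M) : 0 < g.val p (timeField p) (timeField p)

namespace Spacetime

variable {n : ℕ} {M : Type*} [TopologicalSpace M]
    [ChartedSpace (EuclideanSpace ℝ (Fin n)) M] [IsManifold (𝓡 n) ∞ M]

/-- `v` is a future directed timelike vector. -/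
def IsFutureTimelike (S : Spacetime n M) (p : M) (v : TangentSpace (𝓡 n) p) : Prop :=
  0 < S.g.val p v v ∧ 0 < S.g.val p (S.timeField p) v

/-- `v` is a future directed (nonzero) timelike or null vector. -/
def IsFutureCausal (S : Spacetime n M) (p : M) (v : TangentSpace (𝓡 n) p) : Prop :=
  v ≠ 0 ∧ 0 ≤ S.g.val p v v ∧ 0 < S.g.val p (S.timeField p) v

/-- The vector `T^a_b ξ^b = g^{ac} T_{cb} ξ^b`. -/
def contract (S : Spacetime n M)
    (T : ∀ p : M, TangentSpace (𝓡 n) p →L[ℝ] TangentSpace (𝓡 n) p →L[ℝ] ℝ)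
    (p : M) (ξ : TangentSpace (𝓡 n) p) : TangentSpace (𝓡 n) p :=
  S.g.raise p
    { toFun := fun w ↦ T p w ξ
      map_add' := by simp
      map_smul' := by simp
      cont := ((ContinuousEvalConst.continuous_eval_const ξ).comp (T p).continuous) }

/-- The dominant energy condition: `T^a_b ξ^b` is future directed timelike or null (or zero, as
in vacuum) for each future directed timelike `ξ^a`. -/
def DominantEnergyCondition (S : Spacetime n M)
    (T : ∀ p : M, TangentSpace (𝓡 n) p →L[ℝ] TangentSpace (𝓡 n) p →L[ℝ] ℝ) : Prop :=
  ∀ (p : M) (ξ : TangentSpace (𝓡 n) p), S.IsFutureTimelike p ξ →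
    S.contract T p ξ = 0 ∨ S.IsFutureCausal p (S.contract T p ξ)

/-- The data and conditions that make a spacetime one of class A. The type `Z` is the abstract
global cross-section of the Killing horizon `N`. -/
structure ClassA (S : Spacetime n M) (Z : Type*) [TopologicalSpace Z]
    [ChartedSpace (EuclideanSpace ℝ (Fin (n - 2))) Z] [IsManifold (𝓡 (n - 2)) ∞ Z] where
  /-- The cosmological constant. -/
  Λ : ℝ
  /-- The energy-momentum tensor `T_{ab}`. -/
  T (p : M) : TangentSpace (𝓡 n) p →L[ℝ] TangentSpace (𝓡 n) p →L[ℝ] ℝ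
  einstein : S.g.EinsteinEquations Λ T
  dominantEnergy : S.DominantEnergyCondition T
  /-- The one-parameter group `χ_u` of isometries. -/
  χ : ℝ → M → M
  χ_smooth : ContMDiff (𝓘(ℝ, ℝ).prod (𝓡 n)) (𝓡 n) ∞ (fun q : ℝ × M ↦ χ q.1 q.2)
  χ_zero (p : M) : χ 0 p = p
  χ_add (u v : ℝ) (p : M) : χ (u + v) p = χ u (χ v p)
  χ_isometry (u : ℝ) (p : M) (v w : TangentSpace (𝓡 n) p) :
    S.g.val (χ u p) (mfderiv (𝓡 n) (𝓡 n) (χ u) p v) (mfderiv (𝓡 n) (𝓡 n) (χ u) p w)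
      = S.g.val p v w
  /-- The Killing vector field that generates `χ_u`. -/
  K (p : M) : TangentSpace (𝓡 n) p
  K_smooth : ContMDiff (𝓡 n) (𝓡 n).tangent ∞
    (fun p ↦ (⟨p, K p⟩ : TangentBundle (𝓡 n) M))
  K_generates (p : M) : IsMIntegralCurve (I := 𝓡 n) (fun u ↦ χ u p) K
  /-- The Killing horizon. -/
  N : Set M
  N_connected : IsConnected N
  N_null : S.g.IsNullHypersurface N
  N_invariant (u : ℝ) : MapsTo (χ u) N N
  K_null : ∀ p ∈ N, S.g.val p (K p) (K p) = 0
  K_future : ∀ p ∈ N, S.IsFutureCausal p (K p)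
  no_fixed_point : ∀ p ∈ N, ∀ u : ℝ, u ≠ 0 → χ u p ≠ p
  /-- The global cross-section is compact, orientable, and embedded in `N` by `ι`; moving it by
  `χ_u` identifies `ℝ × Z` with `N`, so each orbit of `χ_u` in `N` is a line that meets the
  cross-section exactly once. -/
  ι : Z → M
  Z_compact : CompactSpace Z
  Z_orientable : OrientableManifold (n - 2) Z
  Z_section : Manifold.IsSmoothEmbedding (𝓘(ℝ, ℝ).prod (𝓡 (n - 2))) (𝓡 n) ∞
    (fun q : ℝ × Z ↦ χ q.1 (ι q.2))
  Z_range : range (fun q : ℝ × Z ↦ χ q.1 (ι q.2)) = N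

/-- `κ : N → ℝ` is the surface gravity: `½ ∇^a (K^e K_e) = - κ K^a` on `N`. -/
def ClassA.IsSurfaceGravity {S : Spacetime n M} {Z : Type*} [TopologicalSpace Z]
    [ChartedSpace (EuclideanSpace ℝ (Fin (n - 2))) Z] [IsManifold (𝓡 (n - 2)) ∞ Z]
    (A : S.ClassA Z) (κ : A.N → ℝ) : Prop :=
  ∀ p : A.N, (1 / 2 : ℝ) • S.g.grad (fun q ↦ S.g.val q (A.K q) (A.K q)) p = -(κ p • A.K p)

end Spacetime

end

/-!
Near a point of the horizon there are coordinates in which the horizon is `x^r = 0` and the Killing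
field is `∂/∂x^a`; the components `g_{ij}` are then independent of `x^a`, and `g_{aj} = 0` on the
horizon for `j ≠ r`, because `K` is normal to the horizon. In these coordinates the surface gravity
is `Γ^a_{aa}`, and on the horizon `R_{aj} = -∂_j Γ^a_{aa}` for `j ≠ r`. Stationarity gives
`R_{aa} = 0`, so the Einstein equations yield `T(K, K) = 0`; by the dominant energy condition
`T^a_b K^b` is causal, and being orthogonal to the null vector `K` it is a multiple of `K`. Hence
`T_{aj}`, and with it `R_{aj}`, vanishes on the horizon for `j ≠ r`, and the surface gravity is
locally constant.
-/

/-! ### Causal vectors and the dominant energy condition -/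

namespace LorentzMetric

variable {n : ℕ} {M : Type*} [TopologicalSpace M]
    [ChartedSpace (EuclideanSpace ℝ (Fin n)) M] [IsManifold (𝓡 n) ∞ M]
    (g : LorentzMetric n M) {p : M} {t k v : TangentSpace (𝓡 n) p}

theorem val_self_neg_of_orthogonal_timelike (ht : 0 < g.val p t t) (htv : g.val p t v = 0)
    (hv : v ≠ 0) : g.val p v v < 0 := by
  obtain ⟨s, -, hs⟩ := g.signature p
  by_contra! hvv
  -- the combination of `t` and `v` orthogonal to `s`
  set w := g.val p s v • t - g.val p s t • v with hw
  have hsw : g.val p s w = 0 := by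
    simp only [hw, map_sub, map_smul, smul_eq_mul]
    ring
  have hww : g.val p w w = g.val p s v ^ 2 * g.val p t t + g.val p s t ^ 2 * g.val p v v := by
    simp only [hw, map_sub, map_smul, sub_apply, smul_apply, smul_eq_mul, g.symm p v t, htv]
    ring
  have hw0 : w = 0 := by
    by_contra h
    have := hs w hsw h
    rw [hww] at this
    exact absurd this (not_lt.2 (by positivity))
  have hsv : g.val p s v = 0 := by
    have : g.val p t w = g.val p s v * g.val p t t := by
      simp only [hw, map_sub, map_smul, smul_eq_mul, htv, mul_zero, sub_zero]
    rw [hw0, map_zero] at this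
    exact (mul_eq_zero.1 this.symm).resolve_right ht.ne'
  exact absurd (hs v hsv hv) (not_lt.2 hvv)

theorem val_ne_zero_of_timelike_of_null (ht : 0 < g.val p t t) (hk : k ≠ 0)
    (hkk : g.val p k k = 0) : g.val p t k ≠ 0 :=
  fun h ↦ (g.val_self_neg_of_orthogonal_timelike ht h hk).ne hkk

theorem continuous_val_self (p : M) : Continuous fun v ↦ g.val p v v :=
  let B : EuclideanSpace ℝ (Fin n) →L[ℝ] EuclideanSpace ℝ (Fin n) →L[ℝ] ℝ := g.val p
  B.continuous.clm_apply continuous_id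

theorem exists_eq_smul_of_orthogonal_null (hk : k ≠ 0) (hkk : g.val p k k = 0)
    (hv : 0 ≤ g.val p v v) (hkv : g.val p k v = 0) : ∃ c : ℝ, v = c • k := by
  obtain ⟨t, ht, -⟩ := g.signature p
  have htk := g.val_ne_zero_of_timelike_of_null ht hk hkk
  refine ⟨g.val p t v / g.val p t k, sub_eq_zero.1 ?_⟩
  by_contra hne
  refine absurd (g.val_self_neg_of_orthogonal_timelike ht ?_ hne) (not_lt.2 ?_)
  · simp only [map_sub, map_smul, smul_eq_mul, div_mul_cancel₀ _ htk, sub_self]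
  · simpa only [map_sub, map_smul, sub_apply, smul_apply, smul_eq_mul, hkk, hkv, g.symm p v k,
      mul_zero, sub_zero] using hv

end LorentzMetric

namespace Spacetime

variable {n : ℕ} {M : Type*} [TopologicalSpace M]
    [ChartedSpace (EuclideanSpace ℝ (Fin n)) M] [IsManifold (𝓡 n) ∞ M]
    (S : Spacetime n M) (T : ∀ p : M, TangentSpace (𝓡 n) p →L[ℝ] TangentSpace (𝓡 n) p →L[ℝ] ℝ)
    (p : M)

theorem val_contract (ξ w : TangentSpace (𝓡 n) p) :
    S.g.val p (S.contract T p ξ) w = T p w ξ :=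
  S.g.val_raise p _ w

theorem contract_add (ξ η : TangentSpace (𝓡 n) p) :
    S.contract T p (ξ + η) = S.contract T p ξ + S.contract T p η := by
  apply (S.g.lower_bijective p).1
  ext w
  simp only [map_add, add_apply, val_contract]

theorem contract_smul (c : ℝ) (ξ : TangentSpace (𝓡 n) p) :
    S.contract T p (c • ξ) = c • S.contract T p ξ := by
  apply (S.g.lower_bijective p).1
  ext w
  simp only [map_smul, smul_apply, val_contract]

variable {S T p} {k : TangentSpace (𝓡 n) p}

namespace DominantEnergyCondition

theorem contract_nonneg (hT : S.DominantEnergyCondition T) (hk : S.IsFutureCausal p k) :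
    0 ≤ S.g.val p (S.contract T p k) (S.contract T p k) ∧
      0 ≤ S.g.val p (S.timeField p) (S.contract T p k) := by
  -- `k` is the limit of the future directed timelike vectors `k + ε t` as `ε ↓ 0`
  obtain ⟨-, hkk, htk⟩ := hk
  set t := S.timeField p
  have htt : 0 < S.g.val p t t := S.timeField_timelike p
  have hclosed : IsClosed {v | 0 ≤ S.g.val p v v ∧ 0 ≤ S.g.val p t v} :=
    (isClosed_le continuous_const (S.g.continuous_val_self p)).and
      (isClosed_le continuous_const (S.g.val p t).continuous)
  have hlim : Filter.Tendsto (fun ε : ℝ ↦ S.contract T p k + ε • S.contract T p t)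
      (nhdsWithin 0 (Ioi 0)) (nhds (S.contract T p k)) := by
    have : Continuous fun ε : ℝ ↦ S.contract T p k + ε • S.contract T p t := by fun_prop
    simpa only [zero_smul, add_zero] using (this.tendsto 0).mono_left nhdsWithin_le_nhds
  refine hclosed.mem_of_tendsto hlim ?_
  filter_upwards [self_mem_nhdsWithin] with ε (hε : 0 < ε)
  have htimelike : S.IsFutureTimelike p (k + ε • t) := by
    simp only [IsFutureTimelike, map_add, map_smul, add_apply, smul_apply, smul_eq_mul,
      S.g.symm p k t]
    exact ⟨by positivity, by positivity⟩
  rw [← contract_smul, ← contract_add]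
  rcases hT p _ htimelike with h | h
  · simp [h]
  · exact ⟨h.2.1, h.2.2.le⟩

theorem contract_eq_smul_of_future (hT : S.DominantEnergyCondition T)
    (hk : S.IsFutureCausal p k) (hkk : S.g.val p k k = 0) (hTk : T p k k = 0) :
    ∃ φ : ℝ, 0 ≤ φ ∧ S.contract T p k = φ • k := by
  obtain ⟨hcausal, hfuture⟩ := hT.contract_nonneg hk
  have horth : S.g.val p k (S.contract T p k) = 0 := by rw [S.g.symm, val_contract, hTk]
  obtain ⟨c, hc⟩ := S.g.exists_eq_smul_of_orthogonal_null hk.1 hkk hcausal horth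
  rw [hc, map_smul, smul_eq_mul] at hfuture
  exact ⟨c, nonneg_of_mul_nonneg_left hfuture hk.2.2, hc⟩

theorem contract_eq_smul (hT : S.DominantEnergyCondition T) (hk : k ≠ 0)
    (hkk : S.g.val p k k = 0) (hTk : T p k k = 0) :
    ∃ φ : ℝ, 0 ≤ φ ∧ S.contract T p k = φ • k := by
  rcases lt_or_gt_of_ne
    (S.g.val_ne_zero_of_timelike_of_null (S.timeField_timelike p) hk hkk) with hpast | hfuture
  · obtain ⟨φ, hφ, h⟩ := hT.contract_eq_smul_of_future (k := (-1 : ℝ) • k)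
      ⟨smul_ne_zero (by norm_num) hk, by simp [hkk], by simpa using hpast⟩ (by simp [hkk])
      (by simp [hTk])
    rw [contract_smul, smul_comm] at h
    exact ⟨φ, hφ, smul_right_injective _ (by norm_num : (-1 : ℝ) ≠ 0) h⟩
  · exact hT.contract_eq_smul_of_future ⟨hk, hkk.ge, hfuture⟩ hkk hTk

end DominantEnergyCondition

end Spacetime

/-! ### Partial derivatives and smooth matrices -/

section PartialDeriv

variable {n : ℕ} {F H : EuclideanSpace ℝ (Fin n) → ℝ} {y : EuclideanSpace ℝ (Fin n)}
  {V : Set (EuclideanSpace ℝ (Fin n))}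

theorem partialDeriv_mul (k : Fin n) (hF : DifferentiableAt ℝ F y)
    (hH : DifferentiableAt ℝ H y) :
    partialDeriv k (fun x ↦ F x * H x) y =
      F y * partialDeriv k H y + partialDeriv k F y * H y := by
  simp [partialDeriv, fderiv_fun_mul hF hH, mul_comm]

theorem partialDeriv_sum {ι : Type*} (s : Finset ι) (k : Fin n)
    {f : ι → EuclideanSpace ℝ (Fin n) → ℝ} (hf : ∀ i ∈ s, DifferentiableAt ℝ (f i) y) :
    partialDeriv k (fun x ↦ ∑ i ∈ s, f i x) y = ∑ i ∈ s, partialDeriv k (f i) y := by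
  simp [partialDeriv, fderiv_fun_sum hf]

theorem partialDeriv_congr (k : Fin n) (h : F =ᶠ[nhds y] H) :
    partialDeriv k F y = partialDeriv k H y := by
  rw [partialDeriv, partialDeriv, h.fderiv_eq]

theorem partialDeriv_comm (hF : ContDiffAt ℝ 2 F y) (i j : Fin n) :
    partialDeriv i (partialDeriv j F) y = partialDeriv j (partialDeriv i F) y := by
  have hd : DifferentiableAt ℝ (fderiv ℝ F) y :=
    (hF.fderiv_right (m := 1) (by norm_num)).differentiableAt one_ne_zero
  have second (i j : Fin n) : partialDeriv i (partialDeriv j F) y =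
      fderiv ℝ (fderiv ℝ F) y (EuclideanSpace.single i 1) (EuclideanSpace.single j 1) := by
    change fderiv ℝ (fun x ↦ fderiv ℝ F x (EuclideanSpace.single j (1 : ℝ))) y _ = _
    simp [fderiv_clm_apply hd (differentiableAt_const _)]
  rw [second, second, (hF.isSymmSndFDerivAt (by simp)).eq]

theorem contDiffOn_partialDeriv (hV : IsOpen V) (hF : ContDiffOn ℝ ∞ F V) (k : Fin n) :
    ContDiffOn ℝ ∞ (partialDeriv k F) V :=
  (hF.fderiv_of_isOpen hV (m := ∞) (by simp)).clm_apply contDiffOn_const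

theorem hasDerivAt_comp_line (hF : DifferentiableAt ℝ F y) (k : Fin n) :
    HasDerivAt (fun t : ℝ ↦ F (y + t • EuclideanSpace.single k (1 : ℝ)))
      (partialDeriv k F y) 0 :=
  hF.hasFDerivAt.hasLineDerivAt _

theorem eventually_line_mem (hV : IsOpen V) (hy : y ∈ V) (k : Fin n) :
    ∀ᶠ t : ℝ in nhds 0, y + t • EuclideanSpace.single k (1 : ℝ) ∈ V := by
  have hc : Continuous fun t : ℝ ↦ y + t • EuclideanSpace.single k (1 : ℝ) := by fun_prop
  exact hc.continuousAt.eventually_mem (hV.mem_nhds (by simpa using hy))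

theorem partialDeriv_congr_of_eqOn_hyperplane {r j : Fin n} (hj : j ≠ r) (hV : IsOpen V)
    (h : ∀ x ∈ V, x r = 0 → F x = H x) (hy : y ∈ V) (hyr : y r = 0)
    (hF : DifferentiableAt ℝ F y) (hH : DifferentiableAt ℝ H y) :
    partialDeriv j F y = partialDeriv j H y := by
  refine (hasDerivAt_comp_line hF j).unique
    ((hasDerivAt_comp_line hH j).congr_of_eventuallyEq ?_)
  filter_upwards [eventually_line_mem hV hy j] with t ht
  exact h _ ht (by simp [hyr, hj.symm])

theorem partialDeriv_eq_zero_of_eqOn_hyperplane {r j : Fin n} (hj : j ≠ r) (hV : IsOpen V)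
    (h : ∀ x ∈ V, x r = 0 → F x = 0) (hy : y ∈ V) (hyr : y r = 0)
    (hF : DifferentiableAt ℝ F y) : partialDeriv j F y = 0 := by
  rw [partialDeriv_congr_of_eqOn_hyperplane hj hV h hy hyr hF (differentiableAt_const 0)]
  simp [partialDeriv]

theorem fderiv_eq_sum_partialDeriv (F : EuclideanSpace ℝ (Fin n) → ℝ)
    (y v : EuclideanSpace ℝ (Fin n)) : fderiv ℝ F y v = ∑ j, v j * partialDeriv j F y := by
  conv_lhs => rw [← (EuclideanSpace.basisFun (Fin n) ℝ).sum_repr v, map_sum]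
  simp [partialDeriv]

theorem eq_of_partialDeriv_eq_zero_on_hyperplane {r : Fin n} (hV : Convex ℝ V)
    (hF : ∀ x ∈ V, DifferentiableAt ℝ F x)
    (h : ∀ x ∈ V, x r = 0 → ∀ j, j ≠ r → partialDeriv j F x = 0)
    {y z : EuclideanSpace ℝ (Fin n)} (hy : y ∈ V) (hyr : y r = 0) (hz : z ∈ V) (hzr : z r = 0) :
    F z = F y := by
  obtain ⟨x, hx, hFx⟩ := domain_mvt (fun w hw ↦ (hF w hw).hasFDerivAt.hasFDerivWithinAt) hV hy hz
  have hxV : x ∈ V := hV.segment_subset hy hz hx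
  have hxr : x r = 0 := by
    obtain ⟨α, β, -, -, -, rfl⟩ := hx
    simp [hyr, hzr]
  rw [← sub_eq_zero, hFx, fderiv_eq_sum_partialDeriv]
  refine Finset.sum_eq_zero fun j _ ↦ ?_
  rcases eq_or_ne j r with rfl | hj
  · simp [hyr, hzr]
  · rw [h x hxV hxr j hj, mul_zero]

end PartialDeriv

section MatrixSmooth

variable {𝕜 E ι : Type*} [NontriviallyNormedField 𝕜] [NormedAddCommGroup E] [NormedSpace 𝕜 E]
  [Fintype ι] [DecidableEq ι] {m : WithTop ℕ∞} {V : Set E} {A : E → Matrix ι ι 𝕜}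

theorem contDiffOn_matrix_det (hA : ∀ i j, ContDiffOn 𝕜 m (fun x ↦ A x i j) V) :
    ContDiffOn 𝕜 m (fun x ↦ (A x).det) V := by
  simp only [Matrix.det_apply]
  exact ContDiffOn.sum fun σ _ ↦ (contDiffOn_prod fun i _ ↦ hA _ _).const_smul _

theorem contDiffOn_matrix_inv_apply (hA : ∀ i j, ContDiffOn 𝕜 m (fun x ↦ A x i j) V)
    (hdet : ∀ x ∈ V, (A x).det ≠ 0) (i j : ι) : ContDiffOn 𝕜 m (fun x ↦ (A x)⁻¹ i j) V := by
  simp only [Matrix.inv_def, Matrix.smul_apply, smul_eq_mul, Ring.inverse_eq_inv',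
    Matrix.adjugate_apply]
  refine ((contDiffOn_matrix_det hA).inv hdet).mul (contDiffOn_matrix_det fun k l ↦ ?_)
  by_cases hk : k = j
  · simpa only [hk, Matrix.updateRow_self] using contDiffOn_const
  · simpa only [Matrix.updateRow_ne hk] using hA k l

end MatrixSmooth

/-! ### Charts -/

section InverseFunction

variable {𝕜 E : Type*} [RCLike 𝕜] [NormedAddCommGroup E] [NormedSpace 𝕜 E]

theorem isInvertible_id_add_smulRight {L : E →L[𝕜] 𝕜} {w : E} (h : 1 + L w ≠ 0) :
    (ContinuousLinearMap.id 𝕜 E + L.smulRight w).IsInvertible := by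
  refine .of_inverse (g := .id 𝕜 E - ((1 + L w)⁻¹ • L).smulRight w) ?_ ?_ <;>
  · ext v
    simp only [ContinuousLinearMap.comp_apply, sub_apply, add_apply, ContinuousLinearMap.id_apply,
      ContinuousLinearMap.smulRight_apply, smul_apply, smul_eq_mul, map_add, map_sub, map_smul]
    match_scalars <;> field_simp
    ring

theorem exists_openPartialHomeomorph_of_isInvertible_fderiv [CompleteSpace E]
    {m : WithTop ℕ∞} (hm : m ≠ 0) {F : E → E} {W : Set E} {x₀ : E} (hW : IsOpen W) (hx₀ : x₀ ∈ W)
    (hF : ContDiffOn 𝕜 m F W) (hF' : (fderiv 𝕜 F x₀).IsInvertible) :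
    ∃ e : OpenPartialHomeomorph E E, x₀ ∈ e.source ∧ e.source ⊆ W ∧ (∀ x, e x = F x) ∧
      ContDiffOn 𝕜 m e e.source ∧ ContDiffOn 𝕜 m e.symm e.target := by
  have hFd {x : E} (hx : x ∈ W) : HasFDerivAt F (fderiv 𝕜 F x) x :=
    ((hF.contDiffAt (hW.mem_nhds hx)).differentiableAt hm).hasFDerivAt
  obtain ⟨A, hA⟩ := hF'
  have hAd : HasFDerivAt F (A : E →L[𝕜] E) x₀ := hA ▸ hFd hx₀
  have hF₀ : ContDiffAt 𝕜 m F x₀ := hF.contDiffAt (hW.mem_nhds hx₀)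
  have hcont : ContinuousOn (fderiv 𝕜 F) W :=
    hF.continuousOn_fderiv_of_isOpen hW (ENat.one_le_iff_ne_zero_withTop.2 hm)
  -- The local inverse is smooth at every point that comes from an invertible derivative.
  set W' := W ∩ fderiv 𝕜 F ⁻¹' range ((↑) : (E ≃L[𝕜] E) → E →L[𝕜] E)
  have hW' : IsOpen W' := hcont.isOpen_inter_preimage hW ContinuousLinearEquiv.isOpen
  refine ⟨(hF₀.toOpenPartialHomeomorph F hAd hm).restrOpen W' hW',
    ⟨hF₀.mem_toOpenPartialHomeomorph_source hAd hm, hx₀, A, hA⟩, fun x hx ↦ hx.2.1,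
    fun x ↦ rfl, hF.mono fun x hx ↦ hx.2.1, fun y hy ↦ ?_⟩
  obtain ⟨-, hyW, B, hB⟩ := OpenPartialHomeomorph.map_target _ hy
  exact (OpenPartialHomeomorph.contDiffAt_symm _ hy (f₀' := B) (hB ▸ hFd hyW)
    (hF.contDiffAt (hW.mem_nhds hyW))).contDiffWithinAt

end InverseFunction

section Charts

variable {n : ℕ} {M : Type*} [TopologicalSpace M] [ChartedSpace (EuclideanSpace ℝ (Fin n)) M]
  {φ : OpenPartialHomeomorph M (EuclideanSpace ℝ (Fin n))}
  (hφ : φ ∈ IsManifold.maximalAtlas (𝓡 n) ∞ M) {y : EuclideanSpace ℝ (Fin n)}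
  (hy : y ∈ φ.target)

include hφ in
theorem mdifferentiable_of_mem_maximalAtlas : φ.MDifferentiable (𝓡 n) (𝓡 n) :=
  ⟨(contMDiffOn_of_mem_maximalAtlas hφ).mdifferentiableOn (by simp),
    (contMDiffOn_symm_of_mem_maximalAtlas hφ).mdifferentiableOn (by simp)⟩

include hφ in
theorem contDiffOn_comp_chart_symm {E : Type*} [NormedAddCommGroup E] [NormedSpace ℝ E]
    {U : Set M} {f : M → E} (hf : ContMDiffOn (𝓡 n) 𝓘(ℝ, E) ∞ f U) :
    ContDiffOn ℝ ∞ (f ∘ φ.symm) (φ.target ∩ φ.symm ⁻¹' U) :=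
  contMDiffOn_iff_contDiffOn.1 (hf.comp
    ((contMDiffOn_symm_of_mem_maximalAtlas hφ).mono inter_subset_left) fun _ hx ↦ hx.2)

/-- The coordinate vectors `∂/∂x^i` of the chart `φ` as a basis of the tangent space at the point
with coordinates `y`. -/
noncomputable def coordBasis : Module.Basis (Fin n) ℝ (TangentSpace (𝓡 n) (φ.symm y)) :=
  (EuclideanSpace.basisFun (Fin n) ℝ).toBasis.map
    ((mdifferentiable_of_mem_maximalAtlas hφ).symm.mfderiv hy).toLinearEquiv

@[simp]
theorem coordBasis_apply (i : Fin n) : coordBasis hφ hy i = coordVector φ i y :=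
  congrArg (mfderiv (𝓡 n) (𝓡 n) φ.symm y) (EuclideanSpace.basisFun_apply ..)

include hφ hy in
theorem mvfderiv_coordVector {f : M → ℝ} (hf : MDifferentiableAt (𝓡 n) 𝓘(ℝ, ℝ) f (φ.symm y))
    (j : Fin n) :
    mvfderiv (𝓡 n) f (φ.symm y) (coordVector φ j y) = partialDeriv j (f ∘ φ.symm) y := by
  have := mfderiv_comp y hf
    ((mdifferentiable_of_mem_maximalAtlas hφ).mdifferentiableAt_symm hy)
  rw [mfderiv_eq_fderiv] at this
  rw [partialDeriv, this]
  rfl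

include hφ hy in
theorem exists_partialDeriv_ne_zero {f : M → ℝ}
    (hf : MDifferentiableAt (𝓡 n) 𝓘(ℝ, ℝ) f (φ.symm y))
    (hdf : mvfderiv (𝓡 n) f (φ.symm y) ≠ 0) : ∃ r, partialDeriv r (f ∘ φ.symm) y ≠ 0 := by
  by_contra! h
  refine hdf (ContinuousLinearMap.coe_injective ((coordBasis hφ hy).ext fun j ↦ ?_))
  simpa [h j] using mvfderiv_coordVector hφ hy hf j

variable [IsManifold (𝓡 n) ∞ M]

include hφ in
theorem trans_mem_maximalAtlas
    {e : OpenPartialHomeomorph (EuclideanSpace ℝ (Fin n)) (EuclideanSpace ℝ (Fin n))}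
    (he : ContDiffOn ℝ ∞ e e.source) (he' : ContDiffOn ℝ ∞ e.symm e.target) :
    φ ≫ₕ e ∈ IsManifold.maximalAtlas (𝓡 n) ∞ M := by
  apply OpenPartialHomeomorph.mem_maximalAtlas_of_contMDiffOn
  · exact he.contMDiffOn.comp ((contMDiffOn_of_mem_maximalAtlas hφ).mono fun x hx ↦ hx.1)
      fun x hx ↦ hx.2
  · exact (contMDiffOn_symm_of_mem_maximalAtlas hφ).comp
      (he'.contMDiffOn.mono fun x hx ↦ hx.1) fun x hx ↦ hx.2

include hφ in
theorem contMDiffOn_coordVector (i : Fin n) :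
    ContMDiffOn (𝓡 n) (𝓡 n).tangent ∞
      (fun y ↦ (⟨φ.symm y, coordVector φ i y⟩ : TangentBundle (𝓡 n) M)) φ.target := by
  have hTφ := (contMDiffOn_symm_of_mem_maximalAtlas hφ).contMDiffOn_tangentMapWithin (m := ∞)
    (by simp) φ.open_target.uniqueMDiffOn
  have hconst : ContMDiff (𝓡 n) (𝓡 n).tangent ∞ (fun y : EuclideanSpace ℝ (Fin n) ↦
      (⟨y, EuclideanSpace.single i (1 : ℝ)⟩ :
        TangentBundle (𝓡 n) (EuclideanSpace ℝ (Fin n)))) :=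
    contMDiff_vectorSpace_iff_contDiff
      (V := fun _ ↦ (EuclideanSpace.single i (1 : ℝ) : EuclideanSpace ℝ (Fin n))).2 contDiff_const
  refine (hTφ.comp hconst.contMDiffOn fun y hy ↦ hy).congr fun y hy ↦ ?_
  simp only [Function.comp, tangentMapWithin, coordVector,
    mfderivWithin_of_mem_nhds (φ.open_target.mem_nhds hy)]

theorem exists_chart_apply_eq {U : Set M} {f : M → ℝ} {p : M} (hU : IsOpen U) (hp : p ∈ U)
    (hf : ContMDiffOn (𝓡 n) 𝓘(ℝ, ℝ) ∞ f U) (hdf : mvfderiv (𝓡 n) f p ≠ 0) :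
    ∃ φ ∈ IsManifold.maximalAtlas (𝓡 n) ∞ M, ∃ r : Fin n, p ∈ φ.source ∧ φ.source ⊆ U ∧
      ∀ q ∈ φ.source, φ q r = f q := by
  set φ := chartAt (EuclideanSpace ℝ (Fin n)) p
  have hφ : φ ∈ IsManifold.maximalAtlas (𝓡 n) ∞ M := IsManifold.chart_mem_maximalAtlas p
  have hpφ : p ∈ φ.source := mem_chart_source _ p
  have hsymm : φ.symm (φ p) = p := φ.left_inv hpφ
  obtain ⟨r, hr⟩ : ∃ r, partialDeriv r (f ∘ φ.symm) (φ p) ≠ 0 := by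
    apply exists_partialDeriv_ne_zero hφ (φ.map_source hpφ) <;> rw [hsymm]
    exacts [(hf.contMDiffAt (hU.mem_nhds hp)).mdifferentiableAt (by simp), hdf]
  set W := φ.target ∩ φ.symm ⁻¹' U
  have hW : IsOpen W := φ.isOpen_inter_preimage_symm hU
  have hpW : φ p ∈ W := ⟨φ.map_source hpφ, by rwa [mem_preimage, hsymm]⟩
  have hF : ContDiffOn ℝ ∞ (f ∘ φ.symm) W := contDiffOn_comp_chart_symm hφ hf
  -- replace the `r`-th coordinate by `f`
  let x_r : EuclideanSpace ℝ (Fin n) →L[ℝ] ℝ := EuclideanSpace.proj r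
  let e_r : EuclideanSpace ℝ (Fin n) := EuclideanSpace.single r 1
  let Θ (y : EuclideanSpace ℝ (Fin n)) := y + ((f ∘ φ.symm) y - x_r y) • e_r
  have hΘ : ContDiffOn ℝ ∞ Θ W :=
    contDiffOn_id.add ((hF.sub x_r.contDiff.contDiffOn).smul contDiffOn_const)
  have hΘ' : HasFDerivAt Θ (ContinuousLinearMap.id ℝ _ +
      (fderiv ℝ (f ∘ φ.symm) (φ p) - x_r).smulRight e_r) (φ p) :=
    (hasFDerivAt_id _).add ((((hF.contDiffAt (hW.mem_nhds hpW)).differentiableAt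
      (by simp)).hasFDerivAt.sub x_r.hasFDerivAt).smul_const e_r)
  obtain ⟨e, hpe, heW, heΘ, he, he'⟩ := exists_openPartialHomeomorph_of_isInvertible_fderiv
    (by simp) hW hpW hΘ (hΘ'.fderiv ▸ isInvertible_id_add_smulRight
      (by simpa [x_r, e_r, partialDeriv] using hr))
  refine ⟨φ ≫ₕ e, trans_mem_maximalAtlas hφ he he', r, ⟨hpφ, hpe⟩, fun q hq ↦ ?_, fun q hq ↦ ?_⟩
  · simpa only [mem_preimage, φ.symm_symm, φ.left_inv hq.1] using (heW hq.2).2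
  · simp [heΘ, Θ, x_r, e_r, φ.left_inv hq.1]

end Charts

/-! ### Curvature in coordinates -/

theorem differentiableAt_of_contDiffOn_target {n : ℕ} {M : Type*} [TopologicalSpace M]
    {φ : OpenPartialHomeomorph M (EuclideanSpace ℝ (Fin n))} {F : EuclideanSpace ℝ (Fin n) → ℝ}
    (hF : ContDiffOn ℝ ∞ F φ.target) {y : EuclideanSpace ℝ (Fin n)} (hy : y ∈ φ.target) :
    DifferentiableAt ℝ F y :=
  (hF.contDiffAt (φ.open_target.mem_nhds hy)).differentiableAt (by simp)

namespace LorentzMetric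

variable {n : ℕ} {M : Type*} [TopologicalSpace M]
    [ChartedSpace (EuclideanSpace ℝ (Fin n)) M] [IsManifold (𝓡 n) ∞ M]
    (g : LorentzMetric n M) (φ : OpenPartialHomeomorph M (EuclideanSpace ℝ (Fin n)))

/-- The Christoffel symbols of the first kind
`Γ_{m,ij} = ½ (∂_i g_{jm} + ∂_j g_{im} - ∂_m g_{ij})` in the chart `φ`. -/
noncomputable def christoffelFirst (m i j : Fin n) (y : EuclideanSpace ℝ (Fin n)) : ℝ :=
  (1 / 2) * (partialDeriv i (components g.val φ j m) y + partialDeriv j (components g.val φ i m) y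
    - partialDeriv m (components g.val φ i j) y)

/-- The components of the Riemann tensor in the chart `φ`,
`R^m_{lij} = ∂_i Γ^m_{lj} - ∂_j Γ^m_{li} + Γ^m_{ip} Γ^p_{lj} - Γ^m_{jp} Γ^p_{li}`,
with the sign for which `R_{ij} = R^k_{ikj}`. -/
noncomputable def riemann (m l i j : Fin n) (y : EuclideanSpace ℝ (Fin n)) : ℝ :=
  partialDeriv i (g.christoffel φ m l j) y - partialDeriv j (g.christoffel φ m l i) y +
    ∑ p, (g.christoffel φ m i p y * g.christoffel φ p l j y
      - g.christoffel φ m j p y * g.christoffel φ p l i y)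

theorem components_comm (i j : Fin n) : components g.val φ i j = components g.val φ j i :=
  funext fun _ ↦ g.symm _ _ _

theorem christoffelFirst_comm (m i j : Fin n) :
    g.christoffelFirst φ m i j = g.christoffelFirst φ m j i := by
  funext y
  simp only [christoffelFirst, g.components_comm φ j i, add_comm (partialDeriv i _ y)]

theorem christoffel_comm (k i j : Fin n) : g.christoffel φ k i j = g.christoffel φ k j i := by
  funext y
  simp only [christoffel, g.components_comm φ j i, add_comm (partialDeriv i _ y)]

theorem partialDeriv_components (k i j : Fin n) (y : EuclideanSpace ℝ (Fin n)) :
    partialDeriv k (components g.val φ i j) y =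
      g.christoffelFirst φ i k j y + g.christoffelFirst φ j k i y := by
  simp only [christoffelFirst, g.components_comm φ j i]
  ring

theorem ricci_eq_sum_riemann (i j : Fin n) (y : EuclideanSpace ℝ (Fin n)) :
    g.ricci φ i j y = ∑ k, g.riemann φ k i k j y :=
  Finset.sum_add_distrib.symm

theorem riemann_swap (m l i j : Fin n) (y : EuclideanSpace ℝ (Fin n)) :
    g.riemann φ m l i j y = -g.riemann φ m l j i y := by
  simp only [riemann, Finset.sum_sub_distrib]
  ring

theorem riemann_bianchi (m l i j : Fin n) (y : EuclideanSpace ℝ (Fin n)) :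
    g.riemann φ m l i j y + g.riemann φ m i j l y + g.riemann φ m j l i y = 0 := by
  simp only [riemann, Finset.sum_sub_distrib, g.christoffel_comm φ _ j l,
    g.christoffel_comm φ _ i l, g.christoffel_comm φ _ j i]
  ring

variable {φ} (hφ : φ ∈ IsManifold.maximalAtlas (𝓡 n) ∞ M) {y : EuclideanSpace ℝ (Fin n)}
  (hy : y ∈ φ.target)
include hφ

theorem contDiffOn_components (i j : Fin n) :
    ContDiffOn ℝ ∞ (components g.val φ i j) φ.target := by
  rw [← contMDiffOn_iff_contDiffOn]
  have hg := g.smooth.comp_contMDiffOn (contMDiffOn_symm_of_mem_maximalAtlas hφ)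
  intro y hy
  have := ContMDiffWithinAt.clm_bundle_apply₂ (F₁ := EuclideanSpace ℝ (Fin n))
    (F₂ := EuclideanSpace ℝ (Fin n)) (F₃ := ℝ)
    (E₁ := fun p : M ↦ TangentSpace (𝓡 n) p) (E₂ := fun p : M ↦ TangentSpace (𝓡 n) p)
    (E₃ := fun _ ↦ ℝ) (hg y hy) (contMDiffOn_coordVector hφ i y hy)
    (contMDiffOn_coordVector hφ j y hy)
  rw [Bundle.contMDiffWithinAt_totalSpace] at this
  exact this.2

theorem contDiffOn_christoffelFirst (m i j : Fin n) :
    ContDiffOn ℝ ∞ (g.christoffelFirst φ m i j) φ.target :=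
  have hd (k i j : Fin n) :=
    contDiffOn_partialDeriv φ.open_target (g.contDiffOn_components hφ i j) k
  contDiffOn_const.mul (((hd _ _ _).add (hd _ _ _)).sub (hd _ _ _))

include hy in
theorem det_components_ne_zero : (Matrix.of fun a b ↦ components g.val φ a b y).det ≠ 0 := by
  have hnondeg : (g.val (φ.symm y)).toBilinForm.Nondegenerate :=
    ⟨fun v hv ↦ g.eq_zero_of_forall _ v hv,
      fun v hv ↦ g.eq_zero_of_forall _ v fun w ↦ (g.symm _ v w).trans (hv w)⟩
  have hmatrix : LinearMap.BilinForm.toMatrix (coordBasis hφ hy) (g.val (φ.symm y)).toBilinForm =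
      Matrix.of fun a b ↦ components g.val φ a b y := by
    ext a b
    simp [LinearMap.BilinForm.toMatrix_apply, components]
  exact hmatrix ▸ (LinearMap.BilinForm.nondegenerate_iff_det_ne_zero (coordBasis hφ hy)).1 hnondeg

include hy in
theorem eq_zero_of_sum_components_mul_eq_zero {v : Fin n → ℝ}
    (h : ∀ m, ∑ k, components g.val φ m k y * v k = 0) : v = 0 :=
  Matrix.eq_zero_of_mulVec_eq_zero (g.det_components_ne_zero hφ hy) (funext h)

theorem contDiffOn_christoffel (k i j : Fin n) :
    ContDiffOn ℝ ∞ (g.christoffel φ k i j) φ.target := by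
  have hd (k i j : Fin n) :=
    contDiffOn_partialDeriv φ.open_target (g.contDiffOn_components hφ i j) k
  refine contDiffOn_const.mul (ContDiffOn.sum fun l _ ↦ ContDiffOn.mul ?_
    (((hd _ _ _).add (hd _ _ _)).sub (hd _ _ _)))
  exact contDiffOn_matrix_inv_apply (A := fun y ↦ Matrix.of fun a b ↦ components g.val φ a b y)
    (g.contDiffOn_components hφ) (fun _ ↦ g.det_components_ne_zero hφ) k l

include hy in
theorem sum_components_mul_christoffel (m i j : Fin n) :
    ∑ k, components g.val φ m k y * g.christoffel φ k i j y = g.christoffelFirst φ m i j y := by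
  set G := Matrix.of fun a b ↦ components g.val φ a b y
  have hΓ : (fun k ↦ g.christoffel φ k i j y) =
      G⁻¹.mulVec fun l ↦ g.christoffelFirst φ l i j y := by
    funext k
    simp only [christoffel, Matrix.mulVec, dotProduct, Finset.mul_sum]
    exact Finset.sum_congr rfl fun l _ ↦ mul_left_comm _ _ _
  have hGΓ : G.mulVec (fun k ↦ g.christoffel φ k i j y) = fun l ↦ g.christoffelFirst φ l i j y := by
    rw [hΓ, Matrix.mulVec_mulVec, Matrix.mul_nonsing_inv _ (g.det_components_ne_zero hφ hy).isUnit,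
      Matrix.one_mulVec]
  exact congrFun hGΓ m

include hy in
theorem sum_components_mul_partialDeriv_christoffel (p i l j : Fin n) :
    ∑ m, components g.val φ p m y * partialDeriv i (g.christoffel φ m l j) y =
      partialDeriv i (g.christoffelFirst φ p l j) y -
        ∑ m, partialDeriv i (components g.val φ p m) y * g.christoffel φ m l j y := by
  have hg (m : Fin n) : DifferentiableAt ℝ (components g.val φ p m) y :=
    differentiableAt_of_contDiffOn_target (g.contDiffOn_components hφ p m) hy
  have hΓ (m : Fin n) : DifferentiableAt ℝ (g.christoffel φ m l j) y :=
    differentiableAt_of_contDiffOn_target (g.contDiffOn_christoffel hφ m l j) hy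
  have hlower : g.christoffelFirst φ p l j =ᶠ[nhds y]
      fun x ↦ ∑ m, components g.val φ p m x * g.christoffel φ m l j x :=
    Filter.eventuallyEq_of_mem (φ.open_target.mem_nhds hy) fun x hx ↦
      (g.sum_components_mul_christoffel hφ hx p l j).symm
  rw [partialDeriv_congr i hlower, partialDeriv_sum _ _ fun m _ ↦ (hg m).fun_mul (hΓ m),
    ← Finset.sum_sub_distrib]
  refine Finset.sum_congr rfl fun m _ ↦ ?_
  rw [partialDeriv_mul i (hg m) (hΓ m), add_sub_cancel_right]

include hy in
theorem sum_components_mul_christoffel_mul_christoffel (p i l j : Fin n) :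
    ∑ m, components g.val φ p m y * ∑ q, g.christoffel φ m i q y * g.christoffel φ q l j y =
      ∑ q, g.christoffelFirst φ p i q y * g.christoffel φ q l j y := by
  simp_rw [← g.sum_components_mul_christoffel hφ hy, Finset.mul_sum, Finset.sum_mul, mul_assoc]
  exact Finset.sum_comm

include hy in
theorem sum_components_mul_riemann (p l i j : Fin n) :
    ∑ m, components g.val φ p m y * g.riemann φ m l i j y =
      partialDeriv i (g.christoffelFirst φ p l j) y - partialDeriv j (g.christoffelFirst φ p l i) y
        - ∑ m, g.christoffelFirst φ m i p y * g.christoffel φ m l j y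
        + ∑ m, g.christoffelFirst φ m j p y * g.christoffel φ m l i y := by
  simp only [riemann, mul_add, mul_sub, Finset.sum_sub_distrib, Finset.sum_add_distrib,
    g.sum_components_mul_partialDeriv_christoffel hφ hy,
    g.sum_components_mul_christoffel_mul_christoffel hφ hy, partialDeriv_components, add_mul]
  ring

include hy in
theorem sum_christoffelFirst_mul_christoffel_comm (i j k l : Fin n) :
    ∑ m, g.christoffelFirst φ m i j y * g.christoffel φ m k l y =
      ∑ m, g.christoffelFirst φ m k l y * g.christoffel φ m i j y := by
  simp_rw [← g.sum_components_mul_christoffel hφ hy, Finset.sum_mul]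
  rw [Finset.sum_comm]
  refine Finset.sum_congr rfl fun m _ ↦ Finset.sum_congr rfl fun q _ ↦ ?_
  rw [g.components_comm φ q m]
  ring

include hy in
theorem partialDeriv_christoffelFirst_add (p l i j : Fin n) :
    partialDeriv i (g.christoffelFirst φ p l j) y + partialDeriv i (g.christoffelFirst φ l p j) y =
      partialDeriv i (partialDeriv j (components g.val φ p l)) y := by
  have hΓ (m a b : Fin n) : DifferentiableAt ℝ (g.christoffelFirst φ m a b) y :=
    differentiableAt_of_contDiffOn_target (g.contDiffOn_christoffelFirst hφ m a b) hy
  have hsum : partialDeriv j (components g.val φ p l) =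
      g.christoffelFirst φ p l j + g.christoffelFirst φ l p j := by
    funext x
    rw [partialDeriv_components, g.christoffelFirst_comm φ p, g.christoffelFirst_comm φ l,
      Pi.add_apply]
  rw [hsum, partialDeriv, partialDeriv, partialDeriv, fderiv_add (hΓ _ _ _) (hΓ _ _ _),
    add_apply]

include hy in
theorem sum_components_mul_riemann_antisymm (p l i j : Fin n) :
    ∑ m, components g.val φ p m y * g.riemann φ m l i j y =
      -∑ m, components g.val φ l m y * g.riemann φ m p i j y := by
  have hg : ContDiffAt ℝ 2 (components g.val φ p l) y :=
    ((g.contDiffOn_components hφ p l).contDiffAt (φ.open_target.mem_nhds hy)).of_le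
      (ENat.LEInfty.out)
  have hquad (a b : Fin n) :
      ∑ m, g.christoffelFirst φ m a p y * g.christoffel φ m l b y =
        ∑ m, g.christoffelFirst φ m b l y * g.christoffel φ m p a y := by
    rw [g.sum_christoffelFirst_mul_christoffel_comm hφ hy]
    simp only [g.christoffelFirst_comm φ _ l b, g.christoffel_comm φ _ a p]
  rw [g.sum_components_mul_riemann hφ hy, g.sum_components_mul_riemann hφ hy, hquad i j, hquad j i]
  have hi := g.partialDeriv_christoffelFirst_add hφ hy p l i j
  have hj := g.partialDeriv_christoffelFirst_add hφ hy p l j i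
  linear_combination hi - hj + partialDeriv_comm hg i j

include hy in
theorem sum_riemann_contract_first_eq_zero (i j : Fin n) : ∑ k, g.riemann φ k k i j y = 0 := by
  set G := Matrix.of fun a b ↦ components g.val φ a b y
  set R := Matrix.of fun k l ↦ g.riemann φ k l i j y
  have hsymm : G.transpose = G := Matrix.ext fun a b ↦ congrFun (g.components_comm φ b a) y
  have hanti : R.transpose * G = -(G * R) := by
    rw [← hsymm, ← Matrix.transpose_mul, hsymm]
    ext a b
    exact g.sum_components_mul_riemann_antisymm hφ hy b a i j
  have hdet : IsUnit G.det := (g.det_components_ne_zero hφ hy).isUnit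
  have htrace : R.trace = -R.trace := calc
    R.trace = (R.transpose * G * G⁻¹).trace := by
      rw [Matrix.mul_nonsing_inv_cancel_right _ _ hdet, Matrix.trace_transpose]
    _ = -R.trace := by
      rw [hanti, Matrix.neg_mul, Matrix.trace_neg, Matrix.trace_mul_comm,
        Matrix.nonsing_inv_mul_cancel_left _ _ hdet]
  exact self_eq_neg.1 htrace

include hy in
theorem ricci_comm (i j : Fin n) : g.ricci φ i j y = g.ricci φ j i y := by
  have hbianchi :
      ∑ k, (g.riemann φ k i k j y + g.riemann φ k k j i y + g.riemann φ k j i k y) = 0 :=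
    Finset.sum_eq_zero fun k _ ↦ g.riemann_bianchi φ k i k j y
  simp only [g.riemann_swap φ _ j i, Finset.sum_add_distrib, Finset.sum_neg_distrib,
    g.sum_riemann_contract_first_eq_zero hφ hy, ← ricci_eq_sum_riemann] at hbianchi
  linarith

end LorentzMetric

/-! ### Curvature of a stationary metric along a null hyperplane -/

namespace LorentzMetric

variable {n : ℕ} {M : Type*} [TopologicalSpace M]
    [ChartedSpace (EuclideanSpace ℝ (Fin n)) M] [IsManifold (𝓡 n) ∞ M]
    {g : LorentzMetric n M} {φ : OpenPartialHomeomorph M (EuclideanSpace ℝ (Fin n))}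
    {a r : Fin n}

theorem partialDeriv_christoffel_eq_zero (hφ : φ ∈ IsManifold.maximalAtlas (𝓡 n) ∞ M)
    (hg : ∀ y ∈ φ.target, ∀ i j, partialDeriv a (components g.val φ i j) y = 0)
    {y : EuclideanSpace ℝ (Fin n)} (hy : y ∈ φ.target) (k i j : Fin n) :
    partialDeriv a (g.christoffel φ k i j) y = 0 := by
  have hsecond (i j k : Fin n) :
      partialDeriv a (partialDeriv k (components g.val φ i j)) y = 0 := by
    have hij : ContDiffAt ℝ 2 (components g.val φ i j) y :=
      ((g.contDiffOn_components hφ i j).contDiffAt (φ.open_target.mem_nhds hy)).of_le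
        ENat.LEInfty.out
    rw [partialDeriv_comm hij, partialDeriv_congr k
      (Filter.eventuallyEq_of_mem (φ.open_target.mem_nhds hy) fun x hx ↦ hg x hx i j)]
    simp [partialDeriv]
  -- `∂_a Γ_{m,ij}` is symmetric in `i, j` and antisymmetric in `m, i`
  have hfirst (m i j : Fin n) : partialDeriv a (g.christoffelFirst φ m i j) y = 0 := by
    have hanti (m i j : Fin n) := (g.partialDeriv_christoffelFirst_add hφ hy m i a j).trans
      (hsecond m i j)
    have hmi := hanti m i j
    have hjm := hanti j m i
    have hij := hanti i j m
    rw [g.christoffelFirst_comm φ i m j] at hmi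
    rw [g.christoffelFirst_comm φ m j i] at hjm
    rw [g.christoffelFirst_comm φ j i m] at hij
    linarith
  refine congrFun (g.eq_zero_of_sum_components_mul_eq_zero hφ hy
    (v := fun k ↦ partialDeriv a (g.christoffel φ k i j) y) fun m ↦ ?_) k
  simp [g.sum_components_mul_partialDeriv_christoffel hφ hy, hfirst, hg y hy]

variable (g φ a r) in
/-- `φ` is a chart in which the metric does not depend on `x^a` and `∂/∂x^a` is orthogonal to the
hyperplane `x^r = 0`, to which it is tangent: a chart adapted to a Killing field `∂/∂x^a` with
horizon `x^r = 0`. -/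
structure IsHorizonChart : Prop where
  mem_maximalAtlas : φ ∈ IsManifold.maximalAtlas (𝓡 n) ∞ M
  ne : a ≠ r
  stationary : ∀ y ∈ φ.target, ∀ i j, partialDeriv a (components g.val φ i j) y = 0
  normal : ∀ y ∈ φ.target, y r = 0 → ∀ j, j ≠ r → components g.val φ a j y = 0

namespace IsHorizonChart

variable (h : g.IsHorizonChart φ a r) {y : EuclideanSpace ℝ (Fin n)} (hy : y ∈ φ.target)
  (hyr : y r = 0)
include h hy hyr

theorem components_ne_zero : components g.val φ a r y ≠ 0 := by
  intro har
  have : (Pi.single a 1 : Fin n → ℝ) = 0 :=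
    g.eq_zero_of_sum_components_mul_eq_zero h.mem_maximalAtlas hy fun m ↦ by
      rcases eq_or_ne m r with rfl | hm
      · simpa [Pi.single_apply, g.components_comm φ m a] using har
      · simpa [Pi.single_apply, g.components_comm φ m a] using h.normal y hy hyr m hm
  exact one_ne_zero ((Pi.single_eq_same a 1).symm.trans (congrFun this a))

theorem eq_zero_of_sum_components_mul_eq_zero {v : Fin n → ℝ}
    (hv : ∀ m, m ≠ r → ∑ k, components g.val φ m k y * v k = 0) {k : Fin n} (hk : k ≠ a) :
    v k = 0 := by
  set c := (∑ k, components g.val φ r k y * v k) / components g.val φ a r y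
  have hne : components g.val φ a r y ≠ 0 := h.components_ne_zero hy hyr
  have : v - Pi.single a c = 0 :=
    g.eq_zero_of_sum_components_mul_eq_zero h.mem_maximalAtlas hy fun m ↦ by
      simp only [Pi.sub_apply, Pi.single_apply, mul_sub, Finset.sum_sub_distrib, mul_ite, mul_zero,
        Finset.sum_ite_eq', Finset.mem_univ, if_true]
      rcases eq_or_ne m r with rfl | hm
      · rw [g.components_comm φ m a, mul_div_cancel₀ _ hne, sub_self]
      · rw [hv m hm, g.components_comm φ m a, h.normal y hy hyr m hm, zero_mul, sub_zero]
  simpa [hk] using congrFun this k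

theorem christoffelFirst_eq_zero {m j : Fin n} (hm : m ≠ r) (hj : j ≠ r) :
    g.christoffelFirst φ m a j y = 0 := by
  have htangential {i k : Fin n} (hi : i ≠ r) (hk : k ≠ r) :
      partialDeriv k (components g.val φ a i) y = 0 :=
    partialDeriv_eq_zero_of_eqOn_hyperplane hk φ.open_target
      (fun x hx hxr ↦ h.normal x hx hxr i hi) hy hyr
      (differentiableAt_of_contDiffOn_target (g.contDiffOn_components h.mem_maximalAtlas a i) hy)
  simp [christoffelFirst, h.stationary y hy, htangential hm hj, htangential hj hm]

theorem christoffel_eq_zero {k j : Fin n} (hk : k ≠ a) (hj : j ≠ r) :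
    g.christoffel φ k a j y = 0 :=
  h.eq_zero_of_sum_components_mul_eq_zero hy hyr (v := fun k ↦ g.christoffel φ k a j y)
    (fun m hm ↦ (g.sum_components_mul_christoffel h.mem_maximalAtlas hy m a j).trans
      (h.christoffelFirst_eq_zero hy hyr hm hj)) hk

theorem sum_mul_christoffel {j : Fin n} (hj : j ≠ r) (v : Fin n → ℝ) :
    ∑ k, v k * g.christoffel φ k a j y = v a * g.christoffel φ a a j y :=
  Fintype.sum_eq_single a fun k hk ↦ by rw [h.christoffel_eq_zero hy hyr hk hj, mul_zero]

theorem partialDeriv_components_self (m : Fin n) :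
    partialDeriv m (components g.val φ a a) y =
      -2 * (components g.val φ a m y * g.christoffel φ a a a y) := by
  rw [g.components_comm φ a m,
    ← h.sum_mul_christoffel hy hyr h.ne fun k ↦ components g.val φ m k y,
    g.sum_components_mul_christoffel h.mem_maximalAtlas hy, christoffelFirst,
    h.stationary y hy]
  ring

theorem riemann_transverse_eq_zero (i j : Fin n) : g.riemann φ r a i j y = 0 := by
  have hlower : ∑ m, components g.val φ a m y * g.riemann φ m a i j y = 0 :=
    self_eq_neg.1 (g.sum_components_mul_riemann_antisymm h.mem_maximalAtlas hy a a i j)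
  rw [Fintype.sum_eq_single r fun m hm ↦ by rw [h.normal y hy hyr m hm, zero_mul]] at hlower
  exact (mul_eq_zero.1 hlower).resolve_left (h.components_ne_zero hy hyr)

theorem riemann_tangential_eq_zero {k j : Fin n} (hka : k ≠ a) (hkr : k ≠ r) (hj : j ≠ r) :
    g.riemann φ k a k j y = 0 := by
  have htangential {i l : Fin n} (hi : i ≠ r) (hl : l ≠ r) :
      partialDeriv l (g.christoffel φ k a i) y = 0 :=
    partialDeriv_eq_zero_of_eqOn_hyperplane hl φ.open_target
      (fun x hx hxr ↦ h.christoffel_eq_zero hx hxr hka hi) hy hyr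
      (differentiableAt_of_contDiffOn_target (g.contDiffOn_christoffel h.mem_maximalAtlas k a i) hy)
  rw [riemann, htangential hj hkr, htangential hkr hj, Finset.sum_sub_distrib,
    h.sum_mul_christoffel hy hyr hj, h.sum_mul_christoffel hy hyr hkr,
    g.christoffel_comm φ k k a, g.christoffel_comm φ k j a,
    h.christoffel_eq_zero hy hyr hka hkr, h.christoffel_eq_zero hy hyr hka hj]
  ring

theorem riemann_self {j : Fin n} (hj : j ≠ r) :
    g.riemann φ a a a j y = -partialDeriv j (g.christoffel φ a a a) y := by
  rw [riemann, partialDeriv_christoffel_eq_zero h.mem_maximalAtlas h.stationary hy,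
    Finset.sum_sub_distrib, h.sum_mul_christoffel hy hyr hj, h.sum_mul_christoffel hy hyr h.ne,
    g.christoffel_comm φ a j a]
  ring

theorem ricci_eq {j : Fin n} (hj : j ≠ r) :
    g.ricci φ a j y = -partialDeriv j (g.christoffel φ a a a) y := by
  rw [ricci_eq_sum_riemann, Fintype.sum_eq_single a fun k hk ↦ ?_, h.riemann_self hy hyr hj]
  rcases eq_or_ne k r with rfl | hkr
  · exact h.riemann_transverse_eq_zero hy hyr k j
  · exact h.riemann_tangential_eq_zero hy hyr hk hkr hj

theorem ricci_self : g.ricci φ a a y = 0 := by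
  rw [h.ricci_eq hy hyr h.ne,
    partialDeriv_christoffel_eq_zero h.mem_maximalAtlas h.stationary hy, neg_zero]

end IsHorizonChart

theorem EinsteinEquations.ricci_eq_of_components_eq_zero {Λ : ℝ}
    {T : ∀ p : M, TangentSpace (𝓡 n) p →L[ℝ] TangentSpace (𝓡 n) p →L[ℝ] ℝ}
    (hE : g.EinsteinEquations Λ T) (hφ : φ ∈ IsManifold.maximalAtlas (𝓡 n) ∞ M)
    {y : EuclideanSpace ℝ (Fin n)} (hy : y ∈ φ.target) {i j : Fin n}
    (hij : components g.val φ i j y = 0) :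
    g.ricci φ i j y = 8 * Real.pi * components T φ i j y := by
  simpa [hij] using hE φ hφ y hy i j

end LorentzMetric

/-! ### Killing horizons and adapted charts -/

section Flow

variable {n : ℕ} {M : Type*} [TopologicalSpace M]

/-- The local expression `(u, x) ↦ ψ (χ_u (ψ⁻¹ x))` of a flow in a chart. -/
noncomputable def chartFlow (χ : ℝ → M → M)
    (ψ : OpenPartialHomeomorph M (EuclideanSpace ℝ (Fin n)))
    (q : ℝ × EuclideanSpace ℝ (Fin n)) : EuclideanSpace ℝ (Fin n) :=
  ψ (χ q.1 (ψ.symm q.2))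

/-- The pairs `(u, x)` for which both `x` and the point reached from it after time `u` lie in the
chart `ψ`. -/
def chartFlowDomain (χ : ℝ → M → M) (ψ : OpenPartialHomeomorph M (EuclideanSpace ℝ (Fin n))) :
    Set (ℝ × EuclideanSpace ℝ (Fin n)) :=
  {q | q.2 ∈ ψ.target ∧ χ q.1 (ψ.symm q.2) ∈ ψ.source}

variable {χ : ℝ → M → M} {ψ : OpenPartialHomeomorph M (EuclideanSpace ℝ (Fin n))}
  (hχ₀ : ∀ p, χ 0 p = p) {p : M} (hp : p ∈ ψ.source)

include hχ₀ hp in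
theorem mem_chartFlowDomain : ((0 : ℝ), ψ p) ∈ chartFlowDomain χ ψ :=
  ⟨ψ.map_source hp, by rwa [hχ₀, ψ.left_inv hp]⟩

variable [ChartedSpace (EuclideanSpace ℝ (Fin n)) M]
  (hχ : ContMDiff (𝓘(ℝ, ℝ).prod (𝓡 n)) (𝓡 n) ∞ fun q : ℝ × M ↦ χ q.1 q.2)
  (hψ : ψ ∈ IsManifold.maximalAtlas (𝓡 n) ∞ M)
  {k : EuclideanSpace ℝ (Fin n)} (hk : HasDerivAt (fun u ↦ ψ (χ u p)) k 0)

include hχ in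
theorem isOpen_chartFlowDomain : IsOpen (chartFlowDomain χ ψ) := by
  have hsymm : ContinuousOn (fun q : ℝ × EuclideanSpace ℝ (Fin n) ↦ χ q.1 (ψ.symm q.2))
      (Prod.snd ⁻¹' ψ.target) :=
    hχ.continuous.comp_continuousOn
      (continuousOn_fst.prodMk (ψ.continuousOn_symm.comp continuousOn_snd fun _ hq ↦ hq))
  exact hsymm.isOpen_inter_preimage (ψ.open_target.preimage continuous_snd) ψ.open_source

include hχ hψ in
theorem contDiffOn_chartFlow : ContDiffOn ℝ ∞ (chartFlow χ ψ) (chartFlowDomain χ ψ) := by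
  rw [← contMDiffOn_iff_contDiffOn]
  have hfst : ContMDiffOn 𝓘(ℝ, ℝ × EuclideanSpace ℝ (Fin n)) 𝓘(ℝ, ℝ) ∞
      (Prod.fst : ℝ × EuclideanSpace ℝ (Fin n) → ℝ) (chartFlowDomain χ ψ) :=
    contDiff_fst.contMDiff.contMDiffOn
  have hsnd : ContMDiffOn 𝓘(ℝ, ℝ × EuclideanSpace ℝ (Fin n)) (𝓡 n) ∞
      (fun q : ℝ × EuclideanSpace ℝ (Fin n) ↦ ψ.symm q.2) (chartFlowDomain χ ψ) :=
    (contMDiffOn_symm_of_mem_maximalAtlas hψ).comp contDiff_snd.contMDiff.contMDiffOn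
      fun _ hq ↦ hq.1
  exact (contMDiffOn_of_mem_maximalAtlas hψ).comp (hχ.comp_contMDiffOn (hfst.prodMk hsnd))
    fun _ hq ↦ hq.2

include hχ hψ hχ₀ hp hk in
theorem hasFDerivAt_chartFlow :
    HasFDerivAt (chartFlow χ ψ) (ContinuousLinearMap.snd ℝ ℝ (EuclideanSpace ℝ (Fin n)) +
      (ContinuousLinearMap.fst ℝ ℝ (EuclideanSpace ℝ (Fin n))).smulRight k) (0, ψ p) := by
  have hd : HasFDerivAt (chartFlow χ ψ) (fderiv ℝ (chartFlow χ ψ) (0, ψ p)) (0, ψ p) :=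
    (((contDiffOn_chartFlow hχ hψ).contDiffAt ((isOpen_chartFlowDomain hχ).mem_nhds
      (mem_chartFlowDomain hχ₀ hp))).differentiableAt (by simp)).hasFDerivAt
  have htime : fderiv ℝ (chartFlow χ ψ) (0, ψ p) (1, 0) = k := by
    refine (hd.comp_hasDerivAt (0 : ℝ)
      ((hasDerivAt_id (0 : ℝ)).prodMk (hasDerivAt_const (0 : ℝ) (ψ p)))).unique ?_
    simpa [chartFlow, Function.comp_def, ψ.left_inv hp] using hk
  have hspace (v : EuclideanSpace ℝ (Fin n)) :
      fderiv ℝ (chartFlow χ ψ) (0, ψ p) (0, v) = v := by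
    have hid : (fun x ↦ chartFlow χ ψ (0, x)) =ᶠ[nhds (ψ p)] id :=
      Filter.eventuallyEq_of_mem (ψ.open_target.mem_nhds (ψ.map_source hp)) fun x hx ↦ by
        simp [chartFlow, hχ₀, ψ.right_inv hx]
    exact congrArg (fun L : EuclideanSpace ℝ (Fin n) →L[ℝ] EuclideanSpace ℝ (Fin n) ↦ L v)
      ((hd.comp (ψ p) (hasFDerivAt_prodMk_right 0 (ψ p))).unique
        ((hasFDerivAt_id _).congr_of_eventuallyEq hid))
  refine hd.congr_fderiv (ContinuousLinearMap.ext fun ⟨u, v⟩ ↦ ?_)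
  have hsplit : (u, v) = u • ((1 : ℝ), (0 : EuclideanSpace ℝ (Fin n))) + (0, v) := by simp
  rw [hsplit, map_add, map_smul, htime, hspace]
  simp [add_comm]

variable [IsManifold (𝓡 n) ∞ M]

include hχ hψ hχ₀ hp hk in
theorem exists_chart_symm_apply_eq_flow {a : Fin n} (ha : k a ≠ 0) :
    ∃ φ ∈ IsManifold.maximalAtlas (𝓡 n) ∞ M, p ∈ φ.source ∧ ∀ y ∈ φ.target,
      ψ p + (y - y a • EuclideanSpace.single a (1 : ℝ)) ∈ ψ.target ∧
      φ.symm y = χ (y a) (ψ.symm (ψ p + (y - y a • EuclideanSpace.single a (1 : ℝ)))) := by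
  let x_a : EuclideanSpace ℝ (Fin n) →L[ℝ] ℝ := EuclideanSpace.proj a
  let e_a : EuclideanSpace ℝ (Fin n) := EuclideanSpace.single a 1
  -- flow for the time `x^a` from the slice `x^a = const` through `p`
  let B (y : EuclideanSpace ℝ (Fin n)) := (x_a y, ψ p + (y - x_a y • e_a))
  have hB : ContDiff ℝ ∞ B :=
    x_a.contDiff.prodMk (contDiff_const.add (contDiff_id.sub (x_a.contDiff.smul contDiff_const)))
  have hB₀ : B 0 = (0, ψ p) := by simp [B]
  have hB' : HasFDerivAt B (x_a.prod (ContinuousLinearMap.id ℝ _ - x_a.smulRight e_a)) 0 :=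
    x_a.hasFDerivAt.prodMk (((hasFDerivAt_id _).sub (x_a.hasFDerivAt.smul_const e_a)).const_add _)
  have hΦ' : HasFDerivAt (chartFlow χ ψ ∘ B)
      (ContinuousLinearMap.id ℝ _ + x_a.smulRight (k - e_a)) 0 := by
    refine ((hB₀ ▸ hasFDerivAt_chartFlow hχ₀ hp hχ hψ hk).comp 0 hB').congr_fderiv ?_
    ext1 v
    simp [smul_sub]
    abel
  obtain ⟨e, h0e, heW, heΦ, he, he'⟩ := exists_openPartialHomeomorph_of_isInvertible_fderiv
    (by simp) ((isOpen_chartFlowDomain hχ).preimage hB.continuous)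
    (show B 0 ∈ _ from hB₀ ▸ mem_chartFlowDomain hχ₀ hp)
    ((contDiffOn_chartFlow hχ hψ).comp hB.contDiffOn fun _ hy ↦ hy)
    (hΦ'.fderiv ▸ isInvertible_id_add_smulRight (by simpa [x_a, e_a] using ha))
  refine ⟨ψ ≫ₕ e.symm, trans_mem_maximalAtlas hψ he' (by simpa using he), ⟨hp, ?_⟩, fun y hy ↦ ?_⟩
  · have hmem := e.map_source h0e
    rwa [heΦ, Function.comp_apply, hB₀, chartFlow, hχ₀, ψ.left_inv hp] at hmem
  · obtain ⟨hslice, hflow⟩ := heW hy.1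
    refine ⟨hslice, ?_⟩
    change ψ.symm (e y) = _
    rw [heΦ]
    exact ψ.left_inv hflow

end Flow

namespace LorentzMetric

variable {n : ℕ} {M : Type*} [TopologicalSpace M]
    [ChartedSpace (EuclideanSpace ℝ (Fin n)) M] [IsManifold (𝓡 n) ∞ M]
    {g : LorentzMetric n M} {φ : OpenPartialHomeomorph M (EuclideanSpace ℝ (Fin n))}
    {a r : Fin n}

theorem grad_ne_zero {f : M → ℝ} {p : M} (hf : mvfderiv (𝓡 n) f p ≠ 0) : g.grad f p ≠ 0 :=
  fun h ↦ hf (ContinuousLinearMap.ext fun w ↦ by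
    rw [← g.val_raise p (mvfderiv (𝓡 n) f p) w]
    change g.val p (g.grad f p) w = 0
    rw [h, map_zero, zero_apply])

theorem IsNullHypersurface.components_eq_zero {N : Set M} (hN : g.IsNullHypersurface N)
    (hφ : φ ∈ IsManifold.maximalAtlas (𝓡 n) ∞ M) (hφN : ∀ y ∈ φ.target, φ.symm y ∈ N ↔ y r = 0)
    {y : EuclideanSpace ℝ (Fin n)} (hy : y ∈ φ.target) (hyr : y r = 0) (har : a ≠ r)
    (haa : components g.val φ a a y = 0) {j : Fin n} (hj : j ≠ r) :
    components g.val φ a j y = 0 := by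
  have hq : φ.symm y ∈ N := (hφN y hy).2 hyr
  obtain ⟨U, f, hU, hqU, hf, hNU, hgrad⟩ := hN _ hq
  obtain ⟨hdf, hnull⟩ := hgrad _ ⟨hq, hqU⟩
  have hW : IsOpen (φ.target ∩ φ.symm ⁻¹' U) := φ.isOpen_inter_preimage_symm hU
  have hyW : y ∈ φ.target ∩ φ.symm ⁻¹' U := ⟨hy, hqU⟩
  have htangent {i : Fin n} (hi : i ≠ r) :
      g.val (φ.symm y) (g.grad f (φ.symm y)) (coordVector φ i y) = 0 := by
    rw [grad, val_raise, mvfderiv_coordVector hφ hy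
      ((hf.contMDiffAt (hU.mem_nhds hqU)).mdifferentiableAt (by simp))]
    refine partialDeriv_eq_zero_of_eqOn_hyperplane hi hW (fun x hx hxr ↦ ?_) hyW hyr
      (((contDiffOn_comp_chart_symm hφ hf).contDiffAt (hW.mem_nhds hyW)).differentiableAt (by simp))
    exact (hNU.subset ⟨(hφN x hx.1).2 hxr, hx.2⟩).2
  obtain ⟨c, hc⟩ := g.exists_eq_smul_of_orthogonal_null (grad_ne_zero hdf) hnull haa.ge
    (htangent har)
  rw [components, hc, map_smul, smul_apply, htangent hj, smul_zero]

variable (g) in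
/-- A Killing horizon of the metric `g`: a null hypersurface `N` invariant under a one-parameter
group `χ_u` of isometries whose generator `K` is null and nonzero on `N`. -/
structure KillingHorizon where
  χ : ℝ → M → M
  χ_smooth : ContMDiff (𝓘(ℝ, ℝ).prod (𝓡 n)) (𝓡 n) ∞ (fun q : ℝ × M ↦ χ q.1 q.2)
  χ_zero (p : M) : χ 0 p = p
  χ_add (u v : ℝ) (p : M) : χ (u + v) p = χ u (χ v p)
  χ_isometry (u : ℝ) (p : M) (v w : TangentSpace (𝓡 n) p) :
    g.val (χ u p) (mfderiv (𝓡 n) (𝓡 n) (χ u) p v) (mfderiv (𝓡 n) (𝓡 n) (χ u) p w) = g.val p v w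
  K (p : M) : TangentSpace (𝓡 n) p
  K_generates (p : M) : IsMIntegralCurve (I := 𝓡 n) (fun u ↦ χ u p) K
  N : Set M
  N_null : g.IsNullHypersurface N
  N_invariant (u : ℝ) : MapsTo (χ u) N N
  K_null : ∀ p ∈ N, g.val p (K p) (K p) = 0
  K_ne_zero : ∀ p ∈ N, K p ≠ 0

namespace KillingHorizon

variable (H : g.KillingHorizon)

/-- `κ : N → ℝ` is the surface gravity of the Killing horizon `N`:
`½ ∇^a (K^e K_e) = - κ K^a` on `N`. -/
def IsSurfaceGravity (κ : H.N → ℝ) : Prop :=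
  ∀ p : H.N, (1 / 2 : ℝ) • g.grad (fun q ↦ g.val q (H.K q) (H.K q)) p = -(κ p • H.K p)

theorem χ_mem_N_iff (u : ℝ) (p : M) : H.χ u p ∈ H.N ↔ p ∈ H.N := by
  refine ⟨fun h ↦ ?_, fun h ↦ H.N_invariant u h⟩
  simpa [← H.χ_add, H.χ_zero] using H.N_invariant (-u) h

theorem mdifferentiable_χ (u : ℝ) : MDifferentiable (𝓡 n) (𝓡 n) (H.χ u) :=
  (H.χ_smooth.comp (contMDiff_const.prodMk contMDiff_id)).mdifferentiable (by simp)

theorem hasDerivAt_chart_orbit (hφ : φ ∈ IsManifold.maximalAtlas (𝓡 n) ∞ M) {p : M}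
    (hp : p ∈ φ.source) :
    HasDerivAt (fun u ↦ φ (H.χ u p))
      (mfderiv (𝓡 n) (𝓡 n) φ p (H.K p) : EuclideanSpace ℝ (Fin n)) 0 := by
  have hχ₀ : H.χ 0 p = p := H.χ_zero p
  have hφ' : HasMFDerivAt (𝓡 n) (𝓡 n) φ (H.χ 0 p) (mfderiv (𝓡 n) (𝓡 n) φ (H.χ 0 p)) :=
    ((mdifferentiable_of_mem_maximalAtlas hφ).mdifferentiableAt (by rwa [hχ₀])).hasMFDerivAt
  have h : HasFDerivAt (fun u ↦ φ (H.χ u p)) (_ : ℝ →L[ℝ] EuclideanSpace ℝ (Fin n)) 0 :=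
    (hφ'.comp (0 : ℝ) (H.K_generates p 0)).hasFDerivAt
  have hcomp : HasDerivAt (fun u ↦ φ (H.χ u p))
      (mfderiv (𝓡 n) (𝓡 n) φ (H.χ 0 p) ((1 : ℝ) • H.K (H.χ 0 p)) : EuclideanSpace ℝ (Fin n)) 0 :=
    h.hasDerivAt
  rwa [one_smul, hχ₀] at hcomp

variable (φ a r) in
/-- `φ` is a chart adapted to the Killing horizon: the horizon is `x^r = 0` and the isometries are
the translations along `x^a`. -/
structure IsAdaptedChart : Prop where
  mem_maximalAtlas : φ ∈ IsManifold.maximalAtlas (𝓡 n) ∞ M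
  ne : a ≠ r
  mem_N_iff : ∀ y ∈ φ.target, φ.symm y ∈ H.N ↔ y r = 0
  flow : ∀ y ∈ φ.target, ∀ u : ℝ, y + u • EuclideanSpace.single a (1 : ℝ) ∈ φ.target →
    φ.symm (y + u • EuclideanSpace.single a (1 : ℝ)) = H.χ u (φ.symm y)

theorem exists_isAdaptedChart {p : M} (hp : p ∈ H.N) :
    ∃ (φ : OpenPartialHomeomorph M (EuclideanSpace ℝ (Fin n))) (a r : Fin n),
      H.IsAdaptedChart φ a r ∧ ∃ y ∈ φ.target, y r = 0 ∧ φ.symm y = p := by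
  obtain ⟨U, f, hU, hpU, hf, hNU, hdf⟩ := H.N_null p hp
  obtain ⟨ψ, hψ, r, hpψ, hψU, hψr⟩ := exists_chart_apply_eq hU hpU hf (hdf p ⟨hp, hpU⟩).1
  have hN {q : M} (hq : q ∈ ψ.source) : q ∈ H.N ↔ ψ q r = 0 := by
    simpa [hψU hq, hψr q hq] using Set.ext_iff.1 hNU q
  set k : EuclideanSpace ℝ (Fin n) := mfderiv (𝓡 n) (𝓡 n) ψ p (H.K p)
  have hk : HasDerivAt (fun u ↦ ψ (H.χ u p)) k 0 := H.hasDerivAt_chart_orbit hψ hpψ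
  have hk₀ : k ≠ 0 := fun h ↦ H.K_ne_zero p hp
    ((mdifferentiable_of_mem_maximalAtlas hψ).mfderiv_injective hpψ (h.trans (map_zero _).symm))
  have hkr : k r = 0 := by
    have horbit : Continuous fun u ↦ H.χ u p :=
      H.χ_smooth.continuous.comp (by fun_prop : Continuous fun u : ℝ ↦ (u, p))
    refine ((EuclideanSpace.proj (𝕜 := ℝ) r).hasFDerivAt.comp_hasDerivAt (0 : ℝ) hk).unique
      ((hasDerivAt_const (0 : ℝ) (0 : ℝ)).congr_of_eventuallyEq ?_)
    filter_upwards [horbit.continuousAt.eventually_mem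
      (ψ.open_source.mem_nhds ((H.χ_zero p).symm ▸ hpψ))] with u hu
    exact (hN hu).1 ((H.χ_mem_N_iff u p).2 hp)
  obtain ⟨a, ha⟩ : ∃ a, k a ≠ 0 := by
    by_contra! h
    exact hk₀ (PiLp.ext h)
  have har : a ≠ r := fun h ↦ ha (h ▸ hkr)
  obtain ⟨φ, hφ, hpφ, hflow⟩ := exists_chart_symm_apply_eq_flow H.χ_zero hpψ H.χ_smooth hψ hk ha
  have hφN (y : EuclideanSpace ℝ (Fin n)) (hy : y ∈ φ.target) : φ.symm y ∈ H.N ↔ y r = 0 := by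
    obtain ⟨hslice, hφy⟩ := hflow y hy
    rw [hφy, H.χ_mem_N_iff, hN (ψ.map_target hslice), ψ.right_inv hslice]
    simp [(hN hpψ).1 hp, har.symm]
  refine ⟨φ, a, r, ⟨hφ, har, hφN, fun y hy u hyu ↦ ?_⟩, φ p, φ.map_source hpφ,
    (hφN _ (φ.map_source hpφ)).1 ((φ.left_inv hpφ).symm ▸ hp), φ.left_inv hpφ⟩
  rw [(hflow y hy).2, (hflow _ hyu).2, ← H.χ_add]
  simp [add_comm y, add_smul, add_sub_add_left_eq_sub]

namespace IsAdaptedChart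

variable {H} (h : H.IsAdaptedChart φ a r) {y : EuclideanSpace ℝ (Fin n)} (hy : y ∈ φ.target)
include h hy

theorem K_eq_coordVector : H.K (φ.symm y) = coordVector φ a y := by
  have hφ := mdifferentiable_of_mem_maximalAtlas h.mem_maximalAtlas
  refine hφ.mfderiv_injective (φ.map_target hy) ?_
  have horbit : (fun u ↦ φ (H.χ u (φ.symm y))) =ᶠ[nhds 0]
      fun u ↦ y + u • EuclideanSpace.single a (1 : ℝ) := by
    filter_upwards [eventually_line_mem φ.open_target hy a] with u hu
    rw [← h.flow y hy u hu, φ.right_inv hu]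
  have hline : HasDerivAt (fun u : ℝ ↦ y + u • EuclideanSpace.single a (1 : ℝ))
      (EuclideanSpace.single a (1 : ℝ)) 0 := by
    simpa using ((hasDerivAt_id (0 : ℝ)).smul_const (EuclideanSpace.single a (1 : ℝ))).const_add y
  exact Eq.trans
    ((H.hasDerivAt_chart_orbit h.mem_maximalAtlas (φ.map_target hy)).unique
      (hline.congr_of_eventuallyEq horbit))
    (DFunLike.congr_fun (hφ.comp_symm_deriv hy) (EuclideanSpace.single a (1 : ℝ))).symm

theorem val_K_self : g.val (φ.symm y) (H.K (φ.symm y)) (H.K (φ.symm y)) =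
    components g.val φ a a y := by
  rw [h.K_eq_coordVector hy, components]

theorem mfderiv_χ_coordVector {u : ℝ}
    (hu : y + u • EuclideanSpace.single a (1 : ℝ) ∈ φ.target) (i : Fin n) :
    (mfderiv (𝓡 n) (𝓡 n) (H.χ u) (φ.symm y) (coordVector φ i y) : EuclideanSpace ℝ (Fin n)) =
      coordVector φ i (y + u • EuclideanSpace.single a (1 : ℝ)) := by
  set c : EuclideanSpace ℝ (Fin n) := u • EuclideanSpace.single a (1 : ℝ)
  have hφ := mdifferentiable_of_mem_maximalAtlas h.mem_maximalAtlas
  have hflow : HasMFDerivAt (𝓡 n) (𝓡 n) (H.χ u ∘ φ.symm) y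
      ((mfderiv (𝓡 n) (𝓡 n) (H.χ u) (φ.symm y)).comp (mfderiv (𝓡 n) (𝓡 n) φ.symm y)) :=
    (H.mdifferentiable_χ u (φ.symm y)).hasMFDerivAt.comp y
      (hφ.mdifferentiableAt_symm hy).hasMFDerivAt
  have htranslate : HasMFDerivAt (𝓡 n) (𝓡 n) (fun x ↦ φ.symm (x + c)) y
      (mfderiv (𝓡 n) (𝓡 n) φ.symm (y + c)) :=
    (hφ.mdifferentiableAt_symm hu).hasMFDerivAt.comp y
      ((hasFDerivAt_id y).add_const c).hasMFDerivAt
  have heq : H.χ u ∘ φ.symm =ᶠ[nhds y] fun x ↦ φ.symm (x + c) := by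
    have hcont : Continuous fun x : EuclideanSpace ℝ (Fin n) ↦ x + c := by fun_prop
    filter_upwards [φ.open_target.mem_nhds hy,
      hcont.continuousAt.eventually_mem (φ.open_target.mem_nhds hu)] with x hx hxc
    exact (h.flow x hx u hxc).symm
  exact congrArg (fun L : EuclideanSpace ℝ (Fin n) →L[ℝ] EuclideanSpace ℝ (Fin n) ↦
    L (EuclideanSpace.single i (1 : ℝ)))
    (hasMFDerivAt_unique hflow (htranslate.congr_of_eventuallyEq heq))

theorem components_add_smul {u : ℝ}
    (hu : y + u • EuclideanSpace.single a (1 : ℝ) ∈ φ.target) (i j : Fin n) :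
    components g.val φ i j (y + u • EuclideanSpace.single a (1 : ℝ)) =
      components g.val φ i j y := by
  have hval {p q : M} {v w v' w' : EuclideanSpace ℝ (Fin n)} (hpq : p = q) (hv : v' = v)
      (hw : w' = w) : g.val p v w = g.val q v' w' := by
    subst hpq hv hw
    rfl
  exact (hval (h.flow y hy u hu) (h.mfderiv_χ_coordVector hy hu i)
    (h.mfderiv_χ_coordVector hy hu j)).trans (H.χ_isometry u (φ.symm y) _ _)

omit hy in
theorem isHorizonChart : g.IsHorizonChart φ a r where
  mem_maximalAtlas := h.mem_maximalAtlas
  ne := h.ne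
  stationary y hy i j := by
    refine (hasDerivAt_comp_line (differentiableAt_of_contDiffOn_target
      (g.contDiffOn_components h.mem_maximalAtlas i j) hy) a).unique
      ((hasDerivAt_const (0 : ℝ) (components g.val φ i j y)).congr_of_eventuallyEq ?_)
    filter_upwards [eventually_line_mem φ.open_target hy a] with u hu
    exact h.components_add_smul hy hu i j
  normal y hy hyr j hj := by
    refine H.N_null.components_eq_zero h.mem_maximalAtlas h.mem_N_iff hy hyr h.ne ?_ hj
    rw [← h.val_K_self hy]
    exact H.K_null _ ((h.mem_N_iff y hy).2 hyr)

theorem mdifferentiableAt_val_K_self :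
    MDifferentiableAt (𝓡 n) 𝓘(ℝ, ℝ) (fun q ↦ g.val q (H.K q) (H.K q)) (φ.symm y) := by
  have hcomponents : DifferentiableAt ℝ (components g.val φ a a) (φ (φ.symm y)) := by
    rw [φ.right_inv hy]
    exact differentiableAt_of_contDiffOn_target
      (g.contDiffOn_components h.mem_maximalAtlas a a) hy
  refine (hcomponents.mdifferentiableAt.comp (φ.symm y)
    ((mdifferentiable_of_mem_maximalAtlas h.mem_maximalAtlas).mdifferentiableAt
      (φ.map_target hy))).congr_of_eventuallyEq ?_
  filter_upwards [φ.open_source.mem_nhds (φ.map_target hy)] with q hq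
  rw [Function.comp_apply, ← h.val_K_self (φ.map_source hq), φ.left_inv hq]

theorem half_grad_val_K_self (hyr : y r = 0) :
    (1 / 2 : ℝ) • g.grad (fun q ↦ g.val q (H.K q) (H.K q)) (φ.symm y) =
      -(g.christoffel φ a a a y • H.K (φ.symm y)) := by
  have hgrad (j : Fin n) :
      g.val (φ.symm y) (g.grad (fun q ↦ g.val q (H.K q) (H.K q)) (φ.symm y)) (coordVector φ j y) =
        -2 * (components g.val φ a j y * g.christoffel φ a a a y) := by
    rw [grad, val_raise, mvfderiv_coordVector h.mem_maximalAtlas hy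
      (h.mdifferentiableAt_val_K_self hy), ← h.isHorizonChart.partialDeriv_components_self hy hyr]
    exact partialDeriv_congr j
      (Filter.eventuallyEq_of_mem (φ.open_target.mem_nhds hy) fun x hx ↦ h.val_K_self hx)
  refine (g.lower_bijective _).1 (ContinuousLinearMap.coe_injective
    ((coordBasis h.mem_maximalAtlas hy).ext fun j ↦ ?_))
  rw [coordBasis_apply]
  simp only [ContinuousLinearMap.coe_coe, map_smul, map_neg, neg_apply, smul_apply, hgrad,
    h.K_eq_coordVector hy, smul_eq_mul]
  rw [components]
  ring

theorem surfaceGravity_eq {κ : H.N → ℝ} (hκ : H.IsSurfaceGravity κ) (hN : φ.symm y ∈ H.N) :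
    κ ⟨φ.symm y, hN⟩ = g.christoffel φ a a a y := by
  have hgrad := hκ ⟨φ.symm y, hN⟩
  rw [h.half_grad_val_K_self hy ((h.mem_N_iff y hy).1 hN), neg_inj] at hgrad
  exact (smul_left_injective ℝ (H.K_ne_zero _ hN) hgrad).symm

end IsAdaptedChart

theorem existsUnique_isSurfaceGravity : ∃! κ, H.IsSurfaceGravity κ := by
  have hexists (p : H.N) : ∃ κ : ℝ,
      (1 / 2 : ℝ) • g.grad (fun q ↦ g.val q (H.K q) (H.K q)) p = -(κ • H.K p) := by
    obtain ⟨p, hp⟩ := p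
    obtain ⟨φ, a, r, h, y, hy, hyr, rfl⟩ := H.exists_isAdaptedChart hp
    exact ⟨_, h.half_grad_val_K_self hy hyr⟩
  choose κ hκ using hexists
  refine ⟨κ, hκ, fun κ' hκ' ↦ funext fun p ↦ smul_left_injective ℝ (H.K_ne_zero p p.2) ?_⟩
  exact neg_injective ((hκ' p).symm.trans (hκ p))

variable {S : Spacetime n M} {H : S.g.KillingHorizon} {Λ : ℝ}
  {T : ∀ p : M, TangentSpace (𝓡 n) p →L[ℝ] TangentSpace (𝓡 n) p →L[ℝ] ℝ}
  (hE : S.g.EinsteinEquations Λ T) (hT : S.DominantEnergyCondition T)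
include hE hT

namespace IsAdaptedChart

variable (h : H.IsAdaptedChart φ a r) {y : EuclideanSpace ℝ (Fin n)} (hy : y ∈ φ.target)
  (hyr : y r = 0)
include h hy hyr

theorem contract_eq_smul :
    ∃ c : ℝ, 0 ≤ c ∧ S.contract T (φ.symm y) (H.K (φ.symm y)) = c • H.K (φ.symm y) := by
  have hN : φ.symm y ∈ H.N := (h.mem_N_iff y hy).2 hyr
  refine hT.contract_eq_smul (H.K_ne_zero _ hN) (H.K_null _ hN) ?_
  have hricci : 8 * Real.pi * components T φ a a y = 0 := by
    rw [← hE.ricci_eq_of_components_eq_zero h.mem_maximalAtlas hy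
      (h.isHorizonChart.normal y hy hyr a h.ne), h.isHorizonChart.ricci_self hy hyr]
  rw [h.K_eq_coordVector hy]
  exact (mul_eq_zero.1 hricci).resolve_left (by positivity)

theorem partialDeriv_christoffel_self_eq_zero {j : Fin n} (hj : j ≠ r) :
    partialDeriv j (S.g.christoffel φ a a a) y = 0 := by
  have hnormal : components S.g.val φ a j y = 0 := h.isHorizonChart.normal y hy hyr j hj
  obtain ⟨c, -, hc⟩ := h.contract_eq_smul hE hT hy hyr
  have hTja : components T φ j a y = 0 := by
    rw [components, ← h.K_eq_coordVector hy, ← S.val_contract, hc, map_smul, smul_apply,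
      h.K_eq_coordVector hy]
    exact smul_eq_zero_of_right c hnormal
  have hricci : S.g.ricci φ a j y = 0 := by
    rw [S.g.ricci_comm h.mem_maximalAtlas hy, hE.ricci_eq_of_components_eq_zero h.mem_maximalAtlas
      hy ((congrFun (S.g.components_comm φ j a) y).trans hnormal), hTja, mul_zero]
  rwa [h.isHorizonChart.ricci_eq hy hyr hj, neg_eq_zero] at hricci

end IsAdaptedChart

theorem isLocallyConstant_of_isSurfaceGravity {κ : H.N → ℝ} (hκ : H.IsSurfaceGravity κ) :
    IsLocallyConstant κ := by
  rw [IsLocallyConstant.iff_eventually_eq]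
  rintro ⟨p, hp⟩
  obtain ⟨φ, a, r, h, y, hy, hyr, rfl⟩ := H.exists_isAdaptedChart hp
  obtain ⟨ε, hε, hball⟩ := Metric.isOpen_iff.1 φ.open_target y hy
  have hnhds : φ.source ∩ φ ⁻¹' Metric.ball y ε ∈ nhds (φ.symm y) :=
    (φ.isOpen_inter_preimage Metric.isOpen_ball).mem_nhds
      ⟨φ.map_target hy, by simpa [φ.right_inv hy] using hε⟩
  filter_upwards [continuous_subtype_val.continuousAt.preimage_mem_nhds
    (x := (⟨φ.symm y, hp⟩ : H.N)) hnhds]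
  rintro ⟨q, hq⟩ ⟨hqφ, hqε⟩
  obtain ⟨z, hz, rfl⟩ : ∃ z ∈ φ.target, φ.symm z = q := ⟨φ q, φ.map_source hqφ, φ.left_inv hqφ⟩
  rw [mem_preimage, φ.right_inv hz] at hqε
  rw [h.surfaceGravity_eq hz hκ, h.surfaceGravity_eq hy hκ]
  exact eq_of_partialDeriv_eq_zero_on_hyperplane (convex_ball y ε)
    (fun x hx ↦ differentiableAt_of_contDiffOn_target
      (S.g.contDiffOn_christoffel h.mem_maximalAtlas a a a) (hball hx))
    (fun x hx hxr j hj ↦ h.partialDeriv_christoffel_self_eq_zero hE hT (hball hx) hxr hj)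
    (Metric.mem_ball_self hε) hyr hqε ((h.mem_N_iff z hz).1 hq)

end KillingHorizon

end LorentzMetric

/-- The Killing horizon of a spacetime of class A. -/
def Spacetime.ClassA.killingHorizon {n : ℕ} {M : Type*} [TopologicalSpace M]
    [ChartedSpace (EuclideanSpace ℝ (Fin n)) M] [IsManifold (𝓡 n) ∞ M] {S : Spacetime n M}
    {Z : Type*} [TopologicalSpace Z] [ChartedSpace (EuclideanSpace ℝ (Fin (n - 2))) Z]
    [IsManifold (𝓡 (n - 2)) ∞ Z] (A : S.ClassA Z) : S.g.KillingHorizon where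
  χ := A.χ
  χ_smooth := A.χ_smooth
  χ_zero := A.χ_zero
  χ_add := A.χ_add
  χ_isometry := A.χ_isometry
  K := A.K
  K_generates := A.K_generates
  N := A.N
  N_null := A.N_null
  N_invariant := A.N_invariant
  K_null := A.K_null
  K_ne_zero p hp := (A.K_future p hp).1

theorem lemma4p2_general {n : ℕ} {M : Type*} [TopologicalSpace M]
    [ChartedSpace (EuclideanSpace ℝ (Fin n)) M] [IsManifold (𝓡 n) ∞ M] {S : Spacetime n M}
    (H : S.g.KillingHorizon) (hN : IsPreconnected H.N) {Λ : ℝ}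
    {T : ∀ p : M, TangentSpace (𝓡 n) p →L[ℝ] TangentSpace (𝓡 n) p →L[ℝ] ℝ}
    (hE : S.g.EinsteinEquations Λ T) (hT : S.DominantEnergyCondition T) :
    (∃! κ : H.N → ℝ, H.IsSurfaceGravity κ) ∧
    (∀ κ : H.N → ℝ, H.IsSurfaceGravity κ → ∃ κ₀ : ℝ, ∀ p : H.N, κ p = κ₀) ∧
    (∀ p ∈ H.N, ∃ φ : ℝ, 0 ≤ φ ∧ S.contract T p (H.K p) = φ • H.K p) := by
  refine ⟨H.existsUnique_isSurfaceGravity, fun κ hκ ↦ ?_, fun p hp ↦ ?_⟩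
  · have : PreconnectedSpace H.N := isPreconnected_iff_preconnectedSpace.1 hN
    obtain ⟨κ₀, rfl⟩ :=
      (LorentzMetric.KillingHorizon.isLocallyConstant_of_isSurfaceGravity hE hT hκ).exists_eq_const
    exact ⟨κ₀, fun _ ↦ rfl⟩
  · obtain ⟨φ, a, r, h, y, hy, hyr, rfl⟩ := H.exists_isAdaptedChart hp
    exact h.contract_eq_smul hE hT hy hyr

theorem lemma4p2 {n : ℕ} (hn : 3 ≤ n) {M : Type*} [TopologicalSpace M] [T2Space M]
    [ParacompactSpace M] [ConnectedSpace M] [ChartedSpace (EuclideanSpace ℝ (Fin n)) M]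
    [IsManifold (𝓡 n) ∞ M] {Z : Type*} [TopologicalSpace Z]
    [ChartedSpace (EuclideanSpace ℝ (Fin (n - 2))) Z] [IsManifold (𝓡 (n - 2)) ∞ Z]
    (S : Spacetime n M) (A : S.ClassA Z) :
    (∃! κ : A.N → ℝ, A.IsSurfaceGravity κ) ∧
    (∀ κ : A.N → ℝ, A.IsSurfaceGravity κ → ∃ κ₀ : ℝ, ∀ p : A.N, κ p = κ₀) ∧
    (∀ p ∈ A.N, ∃ φ : ℝ, 0 ≤ φ ∧ S.contract A.T p (A.K p) = φ • A.K p) :=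
  lemma4p2_general A.killingHorizon A.N_connected.isPreconnected A.einstein A.dominantEnergy
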